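/- Let $\mathbb R^k=\mathbb R^{k_1}\times\cdots\times\mathbb R^{k_d}$, write $x=(x^1,\dots,x^d)$ with $x^i\in\mathbb R^{k_i}$, and let $|\cdot|$ be the Euclidean norm. Let $\psi:\mathbb R^k\to\mathbb R$ be measurable and let $\alpha\in\mathbb R$, $\beta>0$, $c>0$, $p\ge 1$ be such that (Q.1) $\psi(x)\ge\alpha+\beta|x|$ for Lebesgue-almost every $x$, (Q.2) $\psi(x)\le c(1+|x|^p)$ for Lebesgue-almost every $x$, (Q.3) $\int_{\mathbb R^k}e^{-\psi(x)}\,dx=1$. Put $\rho(dx)=e^{-\psi(x)}dx$ and $H(\mu)=H(\mu\,\|\,\rho)\in[0,\infty]$ (relative entropy). Let $\mu_0=\mu_0^1\otimes\cdots\otimes\mu_0^d$ be a product probability measure on $\mathbb R^k$ with finite $p$-th moment. A CAVI sequence started at $\mu_0$ is a sequence of product probability measures $\mu_n=\mu_n^1\otimes\cdots\otimes\mu_n^d$, $n\ge0$, such that for all $n\ge 0$ and $i=1,\dots,d$ the integral $$f_{n,i}(x^i)=\int\psi(x^1,\dots,x^d)\,\bigotimes_{j<i}\mu_{n+1}^j(dx^j)\bigotimes_{j>i}\mu_n^j(dx^j)$$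 converges absolutely for almost every $x^i\in\mathbb R^{k_i}$, $0<\int_{\mathbb R^{k_i}} e^{-f_{n,i}(x^i)}\,dx^i<\infty$, and $\mu_{n+1}^i$ has Lebesgue density $e^{-f_{n,i}}/\int e^{-f_{n,i}}$. A stationary point is a product probability measure $\mu=\mu^1\otimes\cdots\otimes\mu^d$ on $\mathbb R^k$ with finite $p$-th moment and $H(\mu)<\infty$ such that for every $i$ and every probability measure $\nu$ on $\mathbb R^{k_i}$ with finite $p$-th moment, $$H(\mu^1\otimes\cdots\otimes\mu^{i-1}\otimes\nu\otimes\mu^{i+1}\otimes\cdots\otimes\mu^d)\ge H(\mu).$$ Then: (a) If, for every $i$, the two bounds $\alpha+\beta|x|\le\psi(x)\le c(1+|x|^p)$ also hold almost everywhere with respect to $dx^1\otimes\cdots\otimes dx^i\otimes\mu_0^{i+1}\otimes\cdots\otimes\mu_0^d$ (this is automatic if the bounds hold everywhere, or if $\mu_0$ is absolutely continuous), then there is exactly one CAVI sequence started at $\mu_0$. (b) For every CAVI sequence $(\mu_n)$ started at $\mu_0$, the set $\{\mu_n : n\ge0\}$ is tight, and every limit of a weakly convergent subsequence of $(\mu_n)$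 is a stationary point of $H$. -/

import Mathlib

open MeasureTheory Filter Topology InformationTheory
open scoped ENNReal

namespace CAVI

/-- `ℝ^{k₁} × ⋯ × ℝ^{k_d}`, the space `ℝ^k` partitioned into `d` blocks. It carries the product
topology and the product Lebesgue measure `volume`. -/
abbrev Space {d : ℕ} (k : Fin d → ℕ) : Type := (i : Fin d) → EuclideanSpace ℝ (Fin (k i))

/-- A vector of marginals `(μ¹, …, μ^d)`, identified with the product measure `μ¹ ⊗ ⋯ ⊗ μ^d`. -/
abbrev Marginals {d : ℕ} (k : Fin d → ℕ) : Type :=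
  (i : Fin d) → ProbabilityMeasure (EuclideanSpace ℝ (Fin (k i)))

variable {d : ℕ} {k : Fin d → ℕ}

/-- The Euclidean norm `|x| = (∑ᵢ |xⁱ|²)^{1/2}` on `ℝ^k` (the bare product type has the sup norm). -/
noncomputable def blockNorm (x : Space k) : ℝ := Real.sqrt (∑ i, ‖x i‖ ^ 2)

/-- The measure `ρ(dx) = e^{-ψ(x)} dx` on `ℝ^k`. -/
noncomputable def target (ψ : Space k → ℝ) : Measure (Space k) :=
  volume.withDensity (fun x => ENNReal.ofReal (Real.exp (-ψ x)))

/-- The relative entropy `H(μ) = H(μ ‖ ρ)`, with values in `[0, ∞]`. -/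
noncomputable def entropy (ψ : Space k → ℝ) (μ : ProbabilityMeasure (Space k)) : ℝ≥0∞ :=
  klDiv (μ : Measure (Space k)) (target ψ)

/-- The partially updated product measure before block `i` is updated in the `n`-th sweep:
blocks `j < i` carry `μ_{n+1}^j`, blocks `j ≥ i` carry `μ_n^j`. -/
noncomputable def partialIterate (μ : ℕ → Marginals k) (n : ℕ) (i : Fin d) : Marginals k :=
  fun j => if j < i then μ (n + 1) j else μ n j

/-- `x ↦ ∫ ψ(xⁱ, y^{-i}) m^{-i}(dy^{-i})`. The `i`-th coordinate of the integration variable `y` is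
overwritten by `x`, so integrating against `m¹ ⊗ ⋯ ⊗ m^d` is integrating against
`m^{-i} = ⊗_{j ≠ i} m^j`. -/
noncomputable def blockPotential (ψ : Space k → ℝ) (m : Marginals k) (i : Fin d)
    (x : EuclideanSpace ℝ (Fin (k i))) : ℝ :=
  ∫ y, ψ (Function.update y i x) ∂(ProbabilityMeasure.pi m : Measure (Space k))

/-- `μ` is a sequence of (well-defined) CAVI iterates: for every sweep `n` and every block `i`, the
integral in the update converges for almost every `xⁱ`, and `μ_{n+1}^i` has Lebesgue density
`e^{-f} / ∫ e^{-f}`, where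
`f(xⁱ) = ∫ ψ(xⁱ, y^{-i}) ⊗_{j < i} μ_{n+1}^j(dy^j) ⊗_{j > i} μ_n^j(dy^j)`.
(`Measure.tilted` is the zero measure if `e^{-f}` is not integrable, so that the equation with the
probability measure `μ_{n+1}^i` includes the finiteness of the normalization constant.) -/
def IsCAVI (ψ : Space k → ℝ) (μ : ℕ → Marginals k) : Prop :=
  ∀ (n : ℕ) (i : Fin d),
    (∀ᵐ x : EuclideanSpace ℝ (Fin (k i)),
      Integrable (fun y : Space k => ψ (Function.update y i x))
        (ProbabilityMeasure.pi (partialIterate μ n i) : Measure (Space k))) ∧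
    (μ (n + 1) i : Measure (EuclideanSpace ℝ (Fin (k i)))) =
      (volume : Measure (EuclideanSpace ℝ (Fin (k i)))).tilted
        (fun x => -blockPotential ψ (partialIterate μ n i) i x)

/-- `dx¹ ⊗ ⋯ ⊗ dxⁱ ⊗ μ₀^{i+1} ⊗ ⋯ ⊗ μ₀^d`, whose null sets matter when block `i` is updated in the
first sweep; for the last block it is Lebesgue measure on `ℝ^k`. -/
noncomputable def firstSweepMeasure (μ₀ : Marginals k) (i : Fin d) : Measure (Space k) :=
  Measure.pi (fun j => if j ≤ i then (volume : Measure (EuclideanSpace ℝ (Fin (k j))))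
    else (μ₀ j : Measure (EuclideanSpace ℝ (Fin (k j)))))

/-- `m` has a finite `p`-th moment on `ℝ^k`. -/
def HasMoment (p : ℝ) (m : ProbabilityMeasure (Space k)) : Prop :=
  Integrable (fun x => blockNorm x ^ p) (m : Measure (Space k))

/-- `m` is a stationary point of `H`: it is a product measure with finite `p`-th moment and finite
entropy, and no replacement of a single marginal by a probability measure with finite `p`-th moment
decreases the entropy. -/
def IsStationary (ψ : Space k → ℝ) (p : ℝ) (m : ProbabilityMeasure (Space k)) : Prop :=
  ∃ q : Marginals k, m = ProbabilityMeasure.pi q ∧ HasMoment p m ∧ entropy ψ m < ∞ ∧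
    ∀ (i : Fin d) (ν : ProbabilityMeasure (EuclideanSpace ℝ (Fin (k i)))),
      Integrable (fun x => ‖x‖ ^ p) (ν : Measure (EuclideanSpace ℝ (Fin (k i)))) →
        entropy ψ m ≤ entropy ψ (ProbabilityMeasure.pi (Function.update q i ν))

end CAVI

/-!
The relative entropy of a product measure is a free energy: if `mʲ = e^{-hʲ} dxʲ`, then
`H(m) = ∫ ψ dm - ∑ⱼ ∫ hʲ dmʲ` (`entropy_eq`). The measure `m'` obtained from `m` by updating block
`i` has `m'ⁱ ∝ e^{-f}` with `f` the `i`-th block potential of `m`. Integrating `log dm'/dρ` over the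
blocks other than `i` gives a constant, because `f` cancels the average of `ψ`
(`integral_sub_sum_eq`). Hence `H(m) = H(mⁱ ‖ m'ⁱ) + H(m')` (`entropy_eq_klDiv_add`), and, combined
with the Donsker–Varadhan inequality, every product measure that is a fixed point of all block
updates is stationary (`isStationary_of_isGibbs`).

*Existence and uniqueness.* A block update of marginals with finite `p`-th moments is well-defined
when the growth bounds hold on almost every section of `ψ` (`blockUpdate_of_growth`), and its
result has exponential tails. In the first sweep this is the extra assumption; afterwards all
marginals are absolutely continuous, and the Lebesgue-a.e. bounds suffice. Uniqueness is immediate,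
since each marginal is determined by the preceding ones.

*Convergence.* An arbitrary CAVI sequence may lose its moments in the first sweep, where the growth
bounds are not available; but its first sweep makes it absolutely continuous, the second restores
the moments, and from the third on the potentials are bounded by multiples of `1 + |x|^p`
(`IsCAVI.isGibbs`). From then on the entropy is finite and decreasing, so the dissipated relative
entropies tend to zero and consecutive iterates merge. Bounded entropy also bounds the
normalization constants from below (`exists_neg_logPartition_le`), so that all later iterates are
dominated by one multiple of a product of the densities `e^{-β|xʲ|}`
(`IsCAVI.exists_domination`). This gives tightness. It also upgrades weak convergence to convergence
of the integrals of arbitrary functions that are integrable for the dominating measure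
(`ProbabilityMeasure.tendsto_integral_of_le`), in particular of the merely measurable sections of
`ψ`: along a convergent subsequence the block potentials converge almost everywhere, and the limit
is a fixed point of every block update (`IsCAVI.isStationary_of_tendsto`).
-/

/-! ### Finite products of measures -/

namespace MeasureTheory.Measure

section Pi

variable {n : ℕ} {E : Fin n → Type*} [∀ i, MeasurableSpace (E i)]

/-- **Tonelli's theorem** for a product of functions of one coordinate each. -/
theorem lintegral_fin_prod_eq_prod (μ : (i : Fin n) → Measure (E i)) [∀ i, SigmaFinite (μ i)]
    {f : (i : Fin n) → E i → ℝ≥0∞} (hf : ∀ i, Measurable (f i)) :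
    ∫⁻ x, ∏ i, f i (x i) ∂(Measure.pi μ) = ∏ i, ∫⁻ x, f i x ∂(μ i) := by
  induction n with
  | zero => simp
  | succ n ih =>
    have h := ((measurePreserving_piFinSuccAbove μ 0).symm).lintegral_comp_emb
      (MeasurableEquiv.measurableEmbedding _) (fun x => ∏ i, f i (x i))
    have e : ∀ x : E 0 × ((i : Fin n) → E (Fin.succAbove 0 i)),
        ∏ i, f i ((MeasurableEquiv.piFinSuccAbove E 0).symm x i) =
          f 0 x.1 * ∏ i, f (Fin.succAbove 0 i) (x.2 i) := fun x => by
      have hx : (MeasurableEquiv.piFinSuccAbove E 0).symm x = Fin.insertNth 0 x.1 x.2 := rfl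
      rw [hx, Fin.prod_univ_succAbove _ 0, Fin.insertNth_apply_same]
      exact congrArg _ (Finset.prod_congr rfl fun i _ => by rw [Fin.insertNth_apply_succAbove])
    rw [← h, lintegral_congr e, lintegral_prod_mul (f := f 0)
      (g := fun y : (i : Fin n) → E (Fin.succAbove 0 i) => ∏ i, f (Fin.succAbove 0 i) (y i))
      (hf 0).aemeasurable (Finset.measurable_prod _ fun i _ =>
        (hf _).comp (measurable_pi_apply i)).aemeasurable,
      ih (fun i => μ (Fin.succAbove 0 i)) (fun i => hf _), Fin.prod_univ_succAbove _ 0]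

theorem pi_withDensity (μ : (i : Fin n) → Measure (E i)) [∀ i, SigmaFinite (μ i)]
    {f : (i : Fin n) → E i → ℝ≥0∞} (hf : ∀ i, Measurable (f i))
    [∀ i, SigmaFinite ((μ i).withDensity (f i))] :
    Measure.pi (fun i => (μ i).withDensity (f i)) =
      (Measure.pi μ).withDensity (fun x => ∏ i, f i (x i)) := by
  refine Measure.pi_eq fun s hs => ?_
  rw [withDensity_apply _ (.univ_pi hs), ← lintegral_indicator (.univ_pi hs)]
  have : ∀ x : (i : Fin n) → E i, (Set.univ.pi s).indicator (fun x => ∏ i, f i (x i)) x =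
      ∏ i, (s i).indicator (f i) (x i) := by
    intro x
    by_cases hx : x ∈ Set.univ.pi s
    · rw [Set.indicator_of_mem hx]
      exact Finset.prod_congr rfl fun i _ => (Set.indicator_of_mem (hx i trivial) _).symm
    · rw [Set.indicator_of_notMem hx]
      simp only [Set.mem_pi, Set.mem_univ, true_imp_iff, not_forall] at hx
      obtain ⟨i, hi⟩ := hx
      exact (Finset.prod_eq_zero (Finset.mem_univ i) (Set.indicator_of_notMem hi _)).symm
  simp_rw [this]
  rw [lintegral_fin_prod_eq_prod μ fun i => (hf i).indicator (hs i)]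
  refine Finset.prod_congr rfl fun i _ => ?_
  rw [lintegral_indicator (hs i), withDensity_apply _ (hs i)]

theorem pi_absolutelyContinuous {μ ν : (i : Fin n) → Measure (E i)} [∀ i, SigmaFinite (μ i)]
    [∀ i, SigmaFinite (ν i)] (h : ∀ i, μ i ≪ ν i) : Measure.pi μ ≪ Measure.pi ν := by
  have e : μ = fun i => (ν i).withDensity ((μ i).rnDeriv (ν i)) :=
    funext fun i => (withDensity_rnDeriv_eq _ _ (h i)).symm
  have : ∀ i, SigmaFinite ((ν i).withDensity ((μ i).rnDeriv (ν i))) := fun i => by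
    rw [withDensity_rnDeriv_eq _ _ (h i)]; infer_instance
  rw [e, pi_withDensity ν fun i => measurable_rnDeriv _ _]
  exact withDensity_absolutelyContinuous _ _

theorem pi_mono {μ ν : (i : Fin n) → Measure (E i)} [∀ i, SigmaFinite (μ i)]
    (h : ∀ i, μ i ≤ ν i) : Measure.pi μ ≤ Measure.pi ν := by
  refine Measure.le_iff.2 fun s hs => ?_
  have key : (Measure.pi μ).toOuterMeasure ≤ OuterMeasure.pi fun i => (ν i).toOuterMeasure := by
    refine OuterMeasure.le_pi.2 fun t _ => ?_
    calc Measure.pi μ (Set.univ.pi t) = ∏ i, μ i (t i) := Measure.pi_pi _ _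
      _ ≤ ∏ i, ν i (t i) := Finset.prod_le_prod' fun i _ => h i _
  calc Measure.pi μ s ≤ (OuterMeasure.pi fun i => (ν i).toOuterMeasure) s := key s
    _ = Measure.pi ν s := by rw [Measure.pi, toMeasure_apply _ _ hs]

theorem measurable_update_pair (i : Fin n) :
    Measurable (fun z : E i × ((j : Fin n) → E j) => Function.update z.2 i z.1) := by
  refine measurable_pi_lambda _ fun j => ?_
  by_cases hj : j = i
  · subst hj
    simpa using measurable_fst
  · simpa [hj, Function.comp_def] using (measurable_pi_apply j).comp measurable_snd

/-- Overwriting the `i`-th coordinate of a sample of `⊗ⱼ mʲ` by an independent sample of `νⁱ`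
produces a sample of `⊗ⱼ νʲ`, where `νʲ = mʲ` for `j ≠ i`. -/
theorem measurePreserving_update (m ν : (i : Fin n) → Measure (E i))
    [∀ i, IsProbabilityMeasure (m i)] [∀ i, SigmaFinite (ν i)] (i : Fin n)
    (h : ∀ j, j ≠ i → ν j = m j) :
    MeasurePreserving (fun z : E i × ((j : Fin n) → E j) => Function.update z.2 i z.1)
      ((ν i).prod (Measure.pi m)) (Measure.pi ν) := by
  refine ⟨measurable_update_pair i, (Measure.pi_eq fun s hs => ?_).symm⟩
  rw [Measure.map_apply (measurable_update_pair i) (.univ_pi hs)]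
  have : (fun z : E i × ((j : Fin n) → E j) => Function.update z.2 i z.1) ⁻¹' (Set.univ.pi s) =
      s i ×ˢ Set.univ.pi (Function.update s i Set.univ) := by
    ext ⟨x, y⟩
    simp only [Set.mem_preimage, Set.mem_pi, Set.mem_univ, true_imp_iff, Set.mem_prod]
    refine ⟨fun H => ⟨by simpa using H i, fun j => ?_⟩, fun H j => ?_⟩
    · by_cases hj : j = i
      · subst hj; simp
      · simpa [hj] using H j
    · by_cases hj : j = i
      · subst hj; simpa using H.1
      · simpa [hj] using H.2 j
  rw [this, Measure.prod_prod, Measure.pi_pi, ← Finset.mul_prod_erase _ _ (Finset.mem_univ i),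
    ← Finset.mul_prod_erase _ (fun j => ν j (s j)) (Finset.mem_univ i)]
  simp only [Function.update_self, measure_univ, one_mul]
  congr 1
  refine Finset.prod_congr rfl fun j hj => ?_
  have hj' := Finset.ne_of_mem_erase hj
  rw [Function.update_of_ne hj', h j hj']

end Pi

end MeasureTheory.Measure

/-! ### Relative entropy -/

namespace InformationTheory

section Entropy

variable {Ω : Type*} [MeasurableSpace Ω]

/-- A probability density written as `e^g` is a tilting with normalization constant `1`. -/
theorem integral_exp_eq_one_of_withDensity {ν P : Measure Ω} [IsProbabilityMeasure P]
    {g : Ω → ℝ} (hg : Measurable g)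
    (h : P = ν.withDensity fun x => ENNReal.ofReal (Real.exp (g x))) :
    Integrable (fun x => Real.exp (g x)) ν ∧ ∫ x, Real.exp (g x) ∂ν = 1 := by
  have h1 : ∫⁻ x, ENNReal.ofReal (Real.exp (g x)) ∂ν = 1 := by
    rw [← setLIntegral_univ, ← withDensity_apply _ .univ, ← h, measure_univ]
  refine ⟨⟨(Real.measurable_exp.comp hg).aestronglyMeasurable, ?_⟩, ?_⟩
  · rw [hasFiniteIntegral_iff_ofReal (ae_of_all _ fun x => (Real.exp_pos _).le), h1]
    exact ENNReal.one_lt_top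
  · rw [integral_eq_lintegral_of_nonneg_ae (ae_of_all _ fun x => (Real.exp_pos _).le)
      (Real.measurable_exp.comp hg).aestronglyMeasurable, h1, ENNReal.toReal_one]

theorem eq_tilted_of_withDensity {ν P : Measure Ω} [IsProbabilityMeasure P]
    {g : Ω → ℝ} (hg : Measurable g)
    (h : P = ν.withDensity fun x => ENNReal.ofReal (Real.exp (g x))) :
    P = ν.tilted g := by
  rw [Measure.tilted, (integral_exp_eq_one_of_withDensity hg h).2, h]
  simp

/-- The relative entropy of `e^g dν` with respect to `ν` is `∫ g e^g dν`. -/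
theorem klDiv_withDensity_exp {ν P : Measure Ω} [IsProbabilityMeasure ν] [IsProbabilityMeasure P]
    {g : Ω → ℝ} (hg : Measurable g)
    (h : P = ν.withDensity fun x => ENNReal.ofReal (Real.exp (g x)))
    (hi : Integrable g P) :
    klDiv P ν = ENNReal.ofReal (∫ x, g x ∂P) ∧ 0 ≤ ∫ x, g x ∂P := by
  obtain ⟨h1, h2⟩ := integral_exp_eq_one_of_withDensity hg h
  have hac : P ≪ ν := h ▸ withDensity_absolutelyContinuous _ _
  have hllr : llr P ν =ᵐ[P] g := by
    refine hac.ae_le (?_ : llr P ν =ᵐ[ν] g)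
    have := log_rnDeriv_tilted_left_self h1
    rw [← eq_tilted_of_withDensity hg h, h2] at this
    simpa only [llr_def, Real.log_one, sub_zero] using this
  have hi' : Integrable (llr P ν) P := hi.congr hllr.symm
  have h3 := toReal_klDiv_of_measure_eq hac (by simp)
  rw [integral_congr_ae hllr] at h3
  rw [← h3]
  exact ⟨(ENNReal.ofReal_toReal (klDiv_ne_top hac hi')).symm, ENNReal.toReal_nonneg⟩

/-- The **Donsker–Varadhan inequality**. -/
theorem integral_le_klDiv_add_log {P ν : Measure Ω} [IsProbabilityMeasure ν]
    [IsProbabilityMeasure P] {g : Ω → ℝ} (hP : klDiv P ν ≠ ∞) (hg : Integrable g P)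
    (he : Integrable (fun x => Real.exp (g x)) ν) :
    ∫ x, g x ∂P ≤ (klDiv P ν).toReal + Real.log (∫ x, Real.exp (g x) ∂ν) := by
  obtain ⟨hac, hi⟩ := klDiv_ne_top_iff.1 hP
  have := isProbabilityMeasure_tilted he
  have hac' : P ≪ ν.tilted g := hac.trans (absolutelyContinuous_tilted he)
  have h1 := integral_llr_tilted_right hac hg he hi
  have h2 := toReal_klDiv_of_measure_eq hac' (by simp)
  have h3 := toReal_klDiv_of_measure_eq hac (by simp)
  have h4 : 0 ≤ (klDiv P (ν.tilted g)).toReal := ENNReal.toReal_nonneg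
  linarith

/-- A quantitative form of the fact that relative entropy controls integrals of bounded
functions; `t` is a free parameter to be chosen small. -/
theorem mul_integral_sub_le {P ν : Measure Ω} [IsProbabilityMeasure ν] [IsProbabilityMeasure P]
    (hP : klDiv P ν ≠ ∞) {g : Ω → ℝ} (hg : Measurable g) {B t : ℝ}
    (hB : ∀ x, |g x| ≤ B) (ht : 0 < t) (htB : t * B ≤ 1) :
    t * (∫ x, g x ∂P - ∫ x, g x ∂ν) ≤ (klDiv P ν).toReal + (t * B) ^ 2 := by
  have hb : ∀ x, |t * g x| ≤ t * B := fun x => by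
    rw [abs_mul, abs_of_pos ht]; exact mul_le_mul_of_nonneg_left (hB x) ht.le
  have hint : ∀ (Q : Measure Ω) [IsProbabilityMeasure Q], Integrable g Q := fun Q _ =>
    Integrable.of_bound hg.aestronglyMeasurable B (ae_of_all _ hB)
  have hexp : ∀ x, Real.exp (t * g x) ≤ 1 + t * g x + (t * B) ^ 2 := fun x => by
    have h1 := Real.abs_exp_sub_one_sub_id_le ((hb x).trans htB)
    have h2 : (t * g x) ^ 2 ≤ (t * B) ^ 2 := sq_le_sq' (abs_le.1 (hb x)).1 (abs_le.1 (hb x)).2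
    linarith [(abs_le.1 h1).2]
  have hie : Integrable (fun x => Real.exp (t * g x)) ν := by
    refine Integrable.of_bound (by fun_prop) (Real.exp 1) (ae_of_all _ fun x => ?_)
    rw [Real.norm_eq_abs, Real.abs_exp]
    exact Real.exp_le_exp.2 (((le_abs_self _).trans (hb x)).trans htB)
  have h1 := integral_le_klDiv_add_log hP ((hint P).const_mul t) hie
  have h2 : ∫ x, Real.exp (t * g x) ∂ν ≤ 1 + t * ∫ x, g x ∂ν + (t * B) ^ 2 := by
    have i1 : Integrable (fun x => 1 + t * g x) ν :=
      (integrable_const 1).add ((hint ν).const_mul t)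
    refine (integral_mono hie (i1.add (integrable_const _)) hexp).trans_eq ?_
    rw [integral_add' i1 (integrable_const _),
      integral_add (integrable_const 1) ((hint ν).const_mul t), integral_const_mul]
    simp
  have h3 := Real.log_le_sub_one_of_pos (integral_exp_pos hie)
  rw [integral_const_mul] at h1
  linarith

/-- If the relative entropy `H(Pₙ ‖ Rₙ)` tends to zero, then `Pₙ` and `Rₙ` have the same limiting
behaviour on bounded functions. -/
theorem tendsto_integral_sub_of_klDiv_tendsto_zero {P R : ℕ → Measure Ω}
    [∀ n, IsProbabilityMeasure (P n)] [∀ n, IsProbabilityMeasure (R n)]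
    (hne : ∀ n, klDiv (P n) (R n) ≠ ∞)
    (h : Tendsto (fun n => (klDiv (P n) (R n)).toReal) atTop (𝓝 0)) {g : Ω → ℝ}
    (hg : Measurable g) {B : ℝ} (hB : ∀ x, |g x| ≤ B) :
    Tendsto (fun n => ∫ x, g x ∂(P n) - ∫ x, g x ∂(R n)) atTop (𝓝 0) := by
  have hB0 : 0 < |B| + 1 := by positivity
  have hB' : ∀ x, |g x| ≤ |B| + 1 := fun x => (hB x).trans (by linarith [le_abs_self B])
  generalize |B| + 1 = C at hB0 hB'
  rw [Metric.tendsto_atTop]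
  intro ε hε
  set t : ℝ := min (1 / C) (ε / (2 * C ^ 2)) with ht
  have ht0 : 0 < t := by positivity
  have htC : t * C ≤ 1 := by
    calc t * C ≤ 1 / C * C := by gcongr; exact min_le_left _ _
      _ = 1 := by field_simp
  have htε : t * C ^ 2 ≤ ε / 2 := by
    calc t * C ^ 2 ≤ ε / (2 * C ^ 2) * C ^ 2 := by gcongr; exact min_le_right _ _
      _ = ε / 2 := by field_simp
  obtain ⟨N, hN⟩ := (Metric.tendsto_atTop.1 h) (t * (ε / 2)) (by positivity)
  refine ⟨N, fun n hn => ?_⟩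
  have hk := hN n hn
  rw [Real.dist_eq, sub_zero] at hk ⊢
  have hk' := (abs_lt.1 hk).2
  have u1 := mul_integral_sub_le (hne n) hg hB' ht0 htC
  have u2 := mul_integral_sub_le (hne n) hg.neg (fun x => by simpa using hB' x) ht0 htC
  simp only [Pi.neg_apply, integral_neg] at u2
  have e : (t * C) ^ 2 ≤ t * (ε / 2) := by
    calc (t * C) ^ 2 = t * (t * C ^ 2) := by ring
      _ ≤ _ := by gcongr
  rw [abs_lt]
  constructor <;> nlinarith

end Entropy

end InformationTheory

/-! ### Weak convergence under domination -/

namespace MeasureTheory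

section Domination

variable {Ω : Type*} [MeasurableSpace Ω] [PseudoEMetricSpace Ω] [BorelSpace Ω]
  {Λ : Measure Ω} [IsFiniteMeasure Λ] {P : ℕ → ProbabilityMeasure Ω} {Q : ProbabilityMeasure Ω}

/-- A common dominating finite measure passes to weak limits. -/
theorem ProbabilityMeasure.le_of_tendsto_of_le (hlim : Tendsto P atTop (𝓝 Q))
    (hP : ∀ n, (P n : Measure Ω) ≤ Λ) : (Q : Measure Ω) ≤ Λ := by
  refine Measure.le_iff.2 fun s _ => ?_
  refine ENNReal.le_of_forall_pos_le_add fun ε hε _ => ?_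
  obtain ⟨U, hsU, hU, hle⟩ := s.exists_isOpen_le_add Λ (ε := ε) (by simpa using hε.ne')
  calc (Q : Measure Ω) s ≤ (Q : Measure Ω) U := measure_mono hsU
    _ ≤ liminf (fun n => (P n : Measure Ω) U) atTop :=
      ProbabilityMeasure.le_liminf_measure_open_of_tendsto hlim hU
    _ ≤ liminf (fun _ => Λ U) atTop := liminf_le_liminf (Eventually.of_forall fun n => hP n U)
    _ = Λ U := liminf_const _
    _ ≤ Λ s + ε := hle

/-- Weakly convergent probability measures with a common dominating finite measure `Λ` converge
when tested against any `Λ`-integrable function, however discontinuous: such a function is an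
`L¹(Λ)`-limit of bounded continuous ones. -/
theorem ProbabilityMeasure.tendsto_integral_of_le (hlim : Tendsto P atTop (𝓝 Q))
    (hP : ∀ n, (P n : Measure Ω) ≤ Λ) {f : Ω → ℝ} (hf : Integrable f Λ) :
    Tendsto (fun n => ∫ x, f x ∂(P n : Measure Ω)) atTop (𝓝 (∫ x, f x ∂(Q : Measure Ω))) := by
  have hQ := ProbabilityMeasure.le_of_tendsto_of_le hlim hP
  rw [Metric.tendsto_atTop]
  intro ε hε
  obtain ⟨g, hg, hgi⟩ := hf.exists_boundedContinuous_integral_sub_le (ε := ε / 3) (by positivity)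
  have key : ∀ M : Measure Ω, M ≤ Λ → |∫ x, f x ∂M - ∫ x, g x ∂M| ≤ ε / 3 := fun M hM => by
    rw [← integral_sub (hf.mono_measure hM) (hgi.mono_measure hM)]
    refine (abs_integral_le_integral_abs).trans (le_trans ?_ hg)
    exact integral_mono_measure hM (ae_of_all _ fun x => abs_nonneg _) (hf.sub hgi).norm
  obtain ⟨N, hN⟩ := Metric.tendsto_atTop.1
    (ProbabilityMeasure.tendsto_iff_forall_integral_tendsto.1 hlim g) (ε / 3) (by positivity)
  refine ⟨N, fun n hn => ?_⟩
  have h1 := key _ (hP n)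
  have h2 := key _ hQ
  have h3 := hN n hn
  rw [Real.dist_eq, abs_lt] at *
  rw [abs_le] at h1 h2
  constructor <;> linarith [h1.1, h1.2, h2.1, h2.2, h3.1, h3.2]

end Domination

end MeasureTheory

namespace CAVI

/-! ### Exponential integrability -/

section Growth

theorem one_add_rpow_le_exp {s b t : ℝ} (hs : 0 < s) (hb : 0 < b) (ht : 0 ≤ t) :
    (1 + t) ^ s ≤ Real.exp (b - s - s * Real.log (b / s)) * Real.exp (b * t) := by
  have h1 : (0 : ℝ) < 1 + t := by linarith
  have h2 := Real.log_le_sub_one_of_pos (x := b / s * (1 + t)) (by positivity)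
  rw [Real.log_mul (by positivity) h1.ne'] at h2
  rw [Real.rpow_def_of_pos h1, ← Real.exp_add]
  refine Real.exp_le_exp.2 ?_
  have h3 : s * (Real.log (b / s) + Real.log (1 + t)) ≤ s * (b / s * (1 + t) - 1) :=
    mul_le_mul_of_nonneg_left h2 hs.le
  have h4 : s * (b / s * (1 + t) - 1) = b * (1 + t) - s := by field_simp
  linarith

theorem rpow_le_one_add_rpow {s p : ℝ} (hs : 0 ≤ s) (hp : 1 ≤ p) : s ≤ 1 + s ^ p := by
  rcases le_total s 1 with h | h
  · linarith [Real.rpow_nonneg hs p]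
  · have := Real.rpow_le_rpow_of_exponent_le h hp
    rw [Real.rpow_one] at this
    linarith

variable {n : ℕ}

theorem integrable_one_add_norm_rpow_mul_exp {q b : ℝ} (hq : 0 ≤ q) (hb : 0 < b) :
    Integrable (fun x : EuclideanSpace ℝ (Fin n) =>
      (1 + ‖x‖) ^ q * Real.exp (-(b * ‖x‖))) := by
  have hr : (Module.finrank ℝ (EuclideanSpace ℝ (Fin n)) : ℝ) < n + 1 := by simp
  have h := (integrable_one_add_norm (μ := (volume : Measure (EuclideanSpace ℝ (Fin n)))) hr)
  have hs : 0 < q + (n + 1) := by positivity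
  refine (h.const_mul (Real.exp (b - (q + (n + 1)) - (q + (n + 1)) *
    Real.log (b / (q + (n + 1)))))).mono' (Measurable.aestronglyMeasurable (by fun_prop))
    (ae_of_all _ fun x => ?_)
  have h1 : (0 : ℝ) < 1 + ‖x‖ := by positivity
  have h2 := one_add_rpow_le_exp hs hb (norm_nonneg x)
  rw [Real.norm_of_nonneg (by positivity)]
  calc (1 + ‖x‖) ^ q * Real.exp (-(b * ‖x‖))
      = (1 + ‖x‖) ^ (q + (n + 1)) * Real.exp (-(b * ‖x‖)) * (1 + ‖x‖) ^ (-((n : ℝ) + 1)) := by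
        rw [mul_right_comm, ← Real.rpow_add h1]; ring_nf
    _ ≤ Real.exp (b - (q + (n + 1)) - (q + (n + 1)) * Real.log (b / (q + (n + 1)))) *
        Real.exp (b * ‖x‖) * Real.exp (-(b * ‖x‖)) * (1 + ‖x‖) ^ (-((n : ℝ) + 1)) := by gcongr
    _ = _ := by
        rw [mul_assoc (Real.exp _) (Real.exp _), ← Real.exp_add, add_neg_cancel, Real.exp_zero,
          mul_one]

theorem integrable_exp_neg_mul_norm {b : ℝ} (hb : 0 < b) :
    Integrable (fun x : EuclideanSpace ℝ (Fin n) => Real.exp (-(b * ‖x‖))) := by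
  simpa using integrable_one_add_norm_rpow_mul_exp (n := n) le_rfl hb

theorem integrable_norm_rpow_mul_exp {p b : ℝ} (hp : 0 ≤ p) (hb : 0 < b) :
    Integrable (fun x : EuclideanSpace ℝ (Fin n) => ‖x‖ ^ p * Real.exp (-(b * ‖x‖))) := by
  refine (integrable_one_add_norm_rpow_mul_exp hp hb).mono'
    (Measurable.aestronglyMeasurable (by fun_prop)) (ae_of_all _ fun x => ?_)
  rw [Real.norm_of_nonneg (by positivity)]
  gcongr
  linarith

end Growth

/-! ### The block norm and moments -/

section BlockNorm

variable {d : ℕ} {k : Fin d → ℕ}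

/-- The `i`-th factor `ℝ^{kᵢ}`. -/
abbrev Block (k : Fin d → ℕ) (i : Fin d) : Type := EuclideanSpace ℝ (Fin (k i))

theorem blockNorm_nonneg (x : Space k) : 0 ≤ blockNorm x := Real.sqrt_nonneg _

@[fun_prop]
theorem measurable_blockNorm : Measurable (blockNorm : Space k → ℝ) := by
  unfold blockNorm; fun_prop

theorem norm_le_blockNorm (x : Space k) (j : Fin d) : ‖x j‖ ≤ blockNorm x :=
  Real.le_sqrt_of_sq_le <|
    Finset.single_le_sum (f := fun i => ‖x i‖ ^ 2) (fun _ _ => sq_nonneg _) (Finset.mem_univ j)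

theorem blockNorm_le_sum (x : Space k) : blockNorm x ≤ ∑ j, ‖x j‖ := by
  rw [blockNorm, Real.sqrt_le_left (Finset.sum_nonneg fun j _ => norm_nonneg _)]
  exact Finset.sum_sq_le_sq_sum_of_nonneg fun _ _ => norm_nonneg _

/-- Up to a constant, the `p`-th power of the Euclidean norm is bounded by the sum of the `p`-th
powers of the block norms. -/
theorem blockNorm_rpow_le {p : ℝ} (hp : 1 ≤ p) (x : Space k) :
    blockNorm x ^ p ≤ (d : ℝ) ^ p * ∑ j, ‖x j‖ ^ p := by
  have hp0 : 0 ≤ p := by linarith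
  rcases Nat.eq_zero_or_pos d with rfl | hd
  · simp [blockNorm, Real.zero_rpow (by linarith : p ≠ 0)]
  obtain ⟨i, -, hi⟩ := Finset.exists_max_image Finset.univ (fun j => ‖x j‖) ⟨⟨0, hd⟩, by simp⟩
  have h1 : blockNorm x ≤ d * ‖x i‖ := by
    refine (blockNorm_le_sum x).trans ((Finset.sum_le_sum fun j hj => hi j hj).trans_eq ?_)
    simp
  calc blockNorm x ^ p ≤ (d * ‖x i‖) ^ p := Real.rpow_le_rpow (blockNorm_nonneg x) h1 hp0
    _ = (d : ℝ) ^ p * ‖x i‖ ^ p := Real.mul_rpow (by positivity) (norm_nonneg _)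
    _ ≤ _ := by
      gcongr
      exact Finset.single_le_sum (f := fun j => ‖x j‖ ^ p)
        (fun j _ => by positivity) (Finset.mem_univ i)

theorem blockNorm_update_rpow_le {p : ℝ} (hp : 1 ≤ p) (i : Fin d)
    (x : Block k i) (y : Space k) :
    blockNorm (Function.update y i x) ^ p ≤ (d : ℝ) ^ p * (‖x‖ ^ p + ∑ j, ‖y j‖ ^ p) := by
  refine (blockNorm_rpow_le hp _).trans ?_
  gcongr
  rw [← Finset.add_sum_erase _ _ (Finset.mem_univ i), Function.update_self]
  gcongr
  refine (Finset.sum_le_sum fun j hj => ?_).trans (Finset.sum_le_univ_sum_of_nonneg fun j => by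
    positivity)
  rw [Function.update_of_ne (Finset.ne_of_mem_erase hj)]

/-- The product measure `m¹ ⊗ ⋯ ⊗ m^d`. -/
noncomputable abbrev jointLaw (m : Marginals k) : Measure (Space k) :=
  (ProbabilityMeasure.pi m : Measure (Space k))

/-- Every factor has a finite `p`-th moment. -/
def HasMoments (p : ℝ) (m : Marginals k) : Prop :=
  ∀ j, Integrable (fun x => ‖x‖ ^ p) (m j : Measure (Block k j))

theorem measurePreserving_eval_pi (m : Marginals k) (j : Fin d) :
    MeasurePreserving (Function.eval j) (jointLaw m) (m j : Measure (Block k j)) :=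
  measurePreserving_eval (fun i => (m i : Measure (Block k i))) j

theorem integrable_comp_eval_pi (m : Marginals k) {j : Fin d}
    {f : Block k j → ℝ} (hf : Integrable f (m j : Measure (Block k j))) :
    Integrable (fun x : Space k => f (x j)) (jointLaw m) :=
  (measurePreserving_eval_pi m j).integrable_comp_of_integrable hf

theorem integral_comp_eval_pi (m : Marginals k) {j : Fin d}
    {f : Block k j → ℝ} (hf : Integrable f (m j : Measure (Block k j))) :
    ∫ x : Space k, f (x j) ∂(jointLaw m) = ∫ x, f x ∂(m j : Measure (Block k j)) := by
  have h := (measurePreserving_eval_pi m j)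
  rw [← h.map_eq, integral_map h.measurable.aemeasurable (by rw [h.map_eq]; exact hf.1)]

theorem HasMoments.hasMoment {p : ℝ} (hp : 1 ≤ p) {m : Marginals k} (h : HasMoments p m) :
    HasMoment p (ProbabilityMeasure.pi m) := by
  refine ((integrable_finsetSum Finset.univ fun j _ =>
    integrable_comp_eval_pi m (h j)).const_mul ((d : ℝ) ^ p)).mono'
    (Measurable.aestronglyMeasurable (by fun_prop)) (ae_of_all _ fun x => ?_)
  rw [Real.norm_of_nonneg (Real.rpow_nonneg (blockNorm_nonneg x) p)]
  exact blockNorm_rpow_le hp x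

theorem HasMoment.hasMoments {p : ℝ} (hp : 1 ≤ p) {m : Marginals k}
    (h : HasMoment p (ProbabilityMeasure.pi m)) : HasMoments p m := by
  intro j
  have : Integrable (fun x : Space k => ‖x j‖ ^ p) (jointLaw m) := by
    refine Integrable.mono' h (Measurable.aestronglyMeasurable (by fun_prop))
      (ae_of_all _ fun x => ?_)
    rw [Real.norm_of_nonneg (by positivity)]
    exact Real.rpow_le_rpow (norm_nonneg _) (norm_le_blockNorm x j) (by linarith)
  exact ((measurePreserving_eval_pi m j).integrable_comp (g := fun x => ‖x‖ ^ p)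
    (Measurable.aestronglyMeasurable (by fun_prop))).1 this

end BlockNorm

end CAVI

namespace CAVI

/-! ### Gibbs measures with potentials of polynomial growth -/

section GibbsMeasures

variable {n : ℕ}

/-- The measure `e^{-h(x)} dx` on `ℝⁿ`. -/
noncomputable def expDensity (h : EuclideanSpace ℝ (Fin n) → ℝ) :
    Measure (EuclideanSpace ℝ (Fin n)) :=
  volume.withDensity fun x => ENNReal.ofReal (Real.exp (-(h x)))

theorem integrable_exp_neg_of_le {f : EuclideanSpace ℝ (Fin n) → ℝ} (hf : Measurable f) {a b : ℝ}
    (hb : 0 < b) (hlow : ∀ᵐ x, a + b * ‖x‖ ≤ f x) : Integrable fun x => Real.exp (-f x) := by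
  refine ((integrable_exp_neg_mul_norm hb).const_mul (Real.exp (-a))).mono'
    (Measurable.aestronglyMeasurable (by fun_prop)) ?_
  filter_upwards [hlow] with x hx
  rw [Real.norm_eq_abs, Real.abs_exp, ← Real.exp_add]
  exact Real.exp_le_exp.2 (by linarith)

theorem integrable_norm_rpow_expDensity {f : EuclideanSpace ℝ (Fin n) → ℝ} (hf : Measurable f)
    {a b p : ℝ} (hp : 0 ≤ p) (hb : 0 < b) (hlow : ∀ᵐ x, a + b * ‖x‖ ≤ f x) :
    Integrable (fun x => ‖x‖ ^ p) (expDensity f) := by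
  rw [expDensity, integrable_withDensity_iff_integrable_smul' (by fun_prop) (by simp)]
  refine ((integrable_norm_rpow_mul_exp hp hb).const_mul (Real.exp (-a))).mono'
    (Measurable.aestronglyMeasurable (by fun_prop)) ?_
  filter_upwards [hlow] with x hx
  rw [ENNReal.toReal_ofReal (Real.exp_pos _).le, smul_eq_mul, Real.norm_of_nonneg (by positivity)]
  have : Real.exp (-f x) ≤ Real.exp (-a) * Real.exp (-(b * ‖x‖)) := by
    rw [← Real.exp_add]
    exact Real.exp_le_exp.2 (by linarith)
  calc Real.exp (-f x) * ‖x‖ ^ p ≤ Real.exp (-a) * Real.exp (-(b * ‖x‖)) * ‖x‖ ^ p := by gcongr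
    _ = _ := by ring

/-- `log ∫ e^{-f}`, the logarithm of the normalization constant. -/
noncomputable def logPartition (f : EuclideanSpace ℝ (Fin n) → ℝ) : ℝ :=
  Real.log (∫ x, Real.exp (-f x))

theorem tilted_neg_eq_expDensity {f : EuclideanSpace ℝ (Fin n) → ℝ}
    (hi : Integrable fun x => Real.exp (-f x)) :
    (volume.tilted fun x => -f x) = expDensity fun x => f x + logPartition f := by
  rw [Measure.tilted, expDensity]
  congr 1
  ext x
  rw [neg_add, Real.exp_add, Real.exp_neg (logPartition f), logPartition,
    Real.exp_log (integral_exp_pos hi), div_eq_mul_inv]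

/-- The measure `ν` has Lebesgue density `e^{-h}`, where the potential `h`
grows at least linearly and at most like `|x|^p`. -/
structure IsGibbs (p : ℝ) (ν : Measure (EuclideanSpace ℝ (Fin n)))
    (h : EuclideanSpace ℝ (Fin n) → ℝ) : Prop where
  measurable : Measurable h
  eq : ν = expDensity h
  growth : ∃ a b A : ℝ, 0 < b ∧ ∀ᵐ x, a + b * ‖x‖ ≤ h x ∧ h x ≤ A * (1 + ‖x‖ ^ p)

theorem isGibbs_tilted {f : EuclideanSpace ℝ (Fin n) → ℝ} (hf : Measurable f) {p a b A : ℝ}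
    (hb : 0 < b) (h : ∀ᵐ x, a + b * ‖x‖ ≤ f x ∧ f x ≤ A * (1 + ‖x‖ ^ p)) :
    IsGibbs p (volume.tilted fun x => -f x) fun x => f x + logPartition f := by
  refine ⟨hf.add_const _, tilted_neg_eq_expDensity
    (integrable_exp_neg_of_le hf hb (h.mono fun x hx => hx.1)),
    a + logPartition f, b, A + |logPartition f|, hb, h.mono fun x hx => ⟨by linarith [hx.1], ?_⟩⟩
  have h1 : 0 ≤ ‖x‖ ^ p := by positivity
  nlinarith [hx.2, le_abs_self (logPartition f), abs_nonneg (logPartition f)]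

variable {p : ℝ} {ν : Measure (EuclideanSpace ℝ (Fin n))} {h : EuclideanSpace ℝ (Fin n) → ℝ}

theorem IsGibbs.absolutelyContinuous (H : IsGibbs p ν h) : ν ≪ volume :=
  H.eq ▸ withDensity_absolutelyContinuous _ _

theorem IsGibbs.integrable_norm_rpow (H : IsGibbs p ν h) {q : ℝ} (hq : 0 ≤ q) :
    Integrable (fun x => ‖x‖ ^ q) ν := by
  obtain ⟨a, b, A, hb, hg⟩ := H.growth
  rw [H.eq]
  exact integrable_norm_rpow_expDensity H.measurable hq hb (hg.mono fun x hx => hx.1)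

/-- A potential of polynomial growth is integrable against any absolutely continuous measure with
a finite `p`-th moment. -/
theorem IsGibbs.integrable_potential (H : IsGibbs p ν h)
    {μ : Measure (EuclideanSpace ℝ (Fin n))} [IsFiniteMeasure μ] (hac : μ ≪ volume)
    (hμ : Integrable (fun x => ‖x‖ ^ p) μ) : Integrable h μ := by
  obtain ⟨a, b, A, hb, hg⟩ := H.growth
  refine (((integrable_const 1).add hμ).const_mul (|a| + |A|)).mono'
    H.measurable.aestronglyMeasurable ?_
  filter_upwards [hac.ae_le hg] with x hx
  have h1 : 0 ≤ ‖x‖ ^ p := by positivity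
  have h2 : 0 ≤ b * ‖x‖ := by positivity
  simp only [Pi.add_apply]
  rw [Real.norm_eq_abs, abs_le]
  constructor
  · nlinarith [hx.1, neg_abs_le a, abs_nonneg a, abs_nonneg A, mul_nonneg (abs_nonneg a) h1,
      mul_nonneg (abs_nonneg A) h1]
  · nlinarith [hx.2, le_abs_self A, abs_nonneg a, mul_nonneg (abs_nonneg a) h1]

/-- Gibbs' inequality with reference density proportional to `e^{-b|x|}`: the differential entropy
of a probability density `e^{-h}` is controlled by its first moment. -/
theorem IsGibbs.integral_potential_le [IsProbabilityMeasure ν] (H : IsGibbs p ν h) (hp : 1 ≤ p)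
    {b : ℝ} (hb : 0 < b) :
    ∫ x, h x ∂ν ≤ b * ∫ x, ‖x‖ ∂ν +
      Real.log (∫ x : EuclideanSpace ℝ (Fin n), Real.exp (-(b * ‖x‖))) := by
  set K : ℝ := ∫ x : EuclideanSpace ℝ (Fin n), Real.exp (-(b * ‖x‖)) with hK
  have hei := integrable_exp_neg_mul_norm (n := n) hb
  have hK0 : 0 < K := integral_exp_pos hei
  have hi := H.integrable_potential H.absolutelyContinuous (H.integrable_norm_rpow (by linarith))
  have hn : Integrable (fun x => ‖x‖) ν := by
    simpa using H.integrable_norm_rpow (q := 1) zero_le_one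
  set g : EuclideanSpace ℝ (Fin n) → ℝ := fun x => h x - b * ‖x‖ - Real.log K with hg
  have hgm : Measurable g := by have := H.measurable; fun_prop
  have e : ∀ x, (ENNReal.ofReal (Real.exp (-h x))).toReal • Real.exp (g x) =
      Real.exp (-(b * ‖x‖)) / K := fun x => by
    rw [ENNReal.toReal_ofReal (Real.exp_pos _).le, smul_eq_mul, ← Real.exp_add,
      show -h x + g x = -(b * ‖x‖) + -Real.log K by simp only [hg]; ring, Real.exp_add,
      Real.exp_neg (Real.log K), Real.exp_log hK0, div_eq_mul_inv]
  have h1 : Integrable (fun x => Real.exp (g x)) ν := by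
    have := H.measurable
    rw [H.eq, expDensity, integrable_withDensity_iff_integrable_smul' (by fun_prop) (by simp)]
    simp_rw [e]
    exact hei.div_const K
  have h2 : ∫ x, Real.exp (g x) ∂ν = 1 := by
    have := H.measurable
    rw [H.eq, expDensity, integral_withDensity_eq_integral_toReal_smul (by fun_prop) (by simp)]
    simp_rw [e]
    rw [integral_div, ← hK, div_self hK0.ne']
  have h3 : Integrable (fun x => h x - b * ‖x‖) ν := hi.sub (hn.const_mul b)
  have h4 : ∫ x, g x ∂ν ≤ ∫ x, (Real.exp (g x) - 1) ∂ν :=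
    integral_mono (h3.sub (integrable_const _)) (h1.sub (integrable_const _))
      fun x => by linarith [Real.add_one_le_exp (g x)]
  rw [integral_sub h1 (integrable_const _), h2, hg, integral_sub h3 (integrable_const _),
    integral_sub hi (hn.const_mul b), integral_const_mul] at h4
  simp at h4
  linarith

end GibbsMeasures

/-! ### Block potentials -/

section BlockUpdate

variable {d : ℕ} {k : Fin d → ℕ}

/-- The two bounds `α + β|x| ≤ ψ(x) ≤ c(1 + |x|^p)` at the point `x`. -/
def Growth (ψ : Space k → ℝ) (α β c p : ℝ) (x : Space k) : Prop :=
  α + β * blockNorm x ≤ ψ x ∧ ψ x ≤ c * (1 + blockNorm x ^ p)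

variable {ψ : Space k → ℝ} {α β c p : ℝ}

theorem Growth.abs_le {x : Space k} (h : Growth ψ α β c p x) (hβ : 0 < β) (hc : 0 < c) :
    |ψ x| ≤ (|α| + c) * (1 + blockNorm x ^ p) := by
  have h1 : 0 ≤ blockNorm x ^ p := Real.rpow_nonneg (blockNorm_nonneg x) p
  have h2 : 0 ≤ β * blockNorm x := mul_nonneg hβ.le (blockNorm_nonneg x)
  rw [_root_.abs_le]
  constructor
  · nlinarith [h.1, neg_abs_le α, abs_nonneg α, mul_nonneg (abs_nonneg α) h1, mul_nonneg hc.le h1]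
  · nlinarith [h.2, abs_nonneg α, mul_nonneg (abs_nonneg α) h1]

theorem integrable_of_growth (hψ : Measurable ψ) (hβ : 0 < β) (hc : 0 < c) (hp : 1 ≤ p)
    {m : Marginals k} (hm : HasMoments p m) (hg : ∀ᵐ x ∂jointLaw m, Growth ψ α β c p x) :
    Integrable ψ (jointLaw m) :=
  (((integrable_const 1).add (hm.hasMoment hp)).const_mul (|α| + c)).mono'
    hψ.aestronglyMeasurable (hg.mono fun _ hx => hx.abs_le hβ hc)

theorem measurable_blockPotential (hψ : Measurable ψ) (m : Marginals k) (i : Fin d) :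
    Measurable (blockPotential ψ m i) :=
  ((hψ.comp (Measure.measurable_update_pair i)).stronglyMeasurable.integral_prod_right'
    (ν := jointLaw m)).measurable

/-- A property that holds almost everywhere for a product of measures dominating `m^{-i}` holds on
almost every `i`-th section. -/
theorem ae_ae_update (m : Marginals k) (i : Fin d) (ν : (j : Fin d) → Measure (Block k j))
    [∀ j, SigmaFinite (ν j)] (hν : ∀ j, j ≠ i → (m j : Measure (Block k j)) ≪ ν j)
    {P : Space k → Prop} (h : ∀ᵐ x ∂Measure.pi ν, P x) :
    ∀ᵐ x ∂ν i, ∀ᵐ y ∂jointLaw m, P (Function.update y i x) := by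
  let ν' : (j : Fin d) → Measure (Block k j) :=
    Function.update (fun j => (m j : Measure (Block k j))) i (ν i)
  have hs : ∀ j, SigmaFinite (ν' j) := fun j => by
    by_cases hj : j = i
    · subst hj; simp only [ν', Function.update_self]; infer_instance
    · simp only [ν', Function.update_of_ne hj]; infer_instance
  have hac : Measure.pi ν' ≪ Measure.pi ν := Measure.pi_absolutelyContinuous fun j => by
    by_cases hj : j = i
    · subst hj; simp only [ν', Function.update_self]; exact Measure.AbsolutelyContinuous.rfl
    · simp only [ν', Function.update_of_ne hj]; exact hν j hj
  have hmp := Measure.measurePreserving_update (fun j => (m j : Measure (Block k j))) ν' i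
    fun j hj => by simp only [ν', Function.update_of_ne hj]
  have h1 := Measure.ae_ae_of_ae_prod (hmp.quasiMeasurePreserving.ae (hac.ae_le h))
  simp only [ν', Function.update_self] at h1
  exact h1

/-- Iterated integration over the `i`-th block and the remaining blocks. -/
theorem integral_jointLaw_eq {m m' : Marginals k} {i : Fin d} (h : ∀ j, j ≠ i → m' j = m j)
    (hi : Integrable ψ (jointLaw m')) :
    Integrable (blockPotential ψ m i) (m' i : Measure (Block k i)) ∧
      ∫ x, ψ x ∂jointLaw m' = ∫ x, blockPotential ψ m i x ∂(m' i : Measure (Block k i)) := by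
  have hmp := Measure.measurePreserving_update (fun j => (m j : Measure (Block k j)))
    (fun j => (m' j : Measure (Block k j))) i fun j hj => by rw [h j hj]
  have h1 := hmp.integrable_comp_of_integrable hi
  refine ⟨h1.integral_prod_left, ?_⟩
  have h2 := integral_prod _ h1
  have h3 := hmp.map_eq
  change Measure.map _ _ = jointLaw m' at h3
  rw [← h3, integral_map hmp.measurable.aemeasurable (by rw [h3]; exact hi.1)]
  exact h2

theorem le_blockPotential {m : Marginals k} {i : Fin d} {x : Block k i} (hβ : 0 < β)
    (hi : Integrable (fun y => ψ (Function.update y i x)) (jointLaw m))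
    (hg : ∀ᵐ y ∂jointLaw m, Growth ψ α β c p (Function.update y i x)) :
    α + β * ‖x‖ ≤ blockPotential ψ m i x := by
  have h1 : ∫ _, (α + β * ‖x‖) ∂jointLaw m ≤ blockPotential ψ m i x := by
    refine integral_mono_ae (integrable_const _) hi (hg.mono fun y hy => le_trans ?_ hy.1)
    have := norm_le_blockNorm (Function.update y i x) i
    rw [Function.update_self] at this
    change α + β * ‖x‖ ≤ α + β * blockNorm (Function.update y i x)
    gcongr
  simpa using h1

/-- On sections where `ψ` satisfies the growth bounds, so does the block potential, with the
exponent `p` and a constant that depends on the moments of `m`. -/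
theorem exists_blockPotential_growth (hψ : Measurable ψ) (hβ : 0 < β) (hc : 0 < c) (hp : 1 ≤ p)
    {m : Marginals k} (hm : HasMoments p m) :
    ∃ A : ℝ, ∀ (i : Fin d) (x : Block k i),
      (∀ᵐ y ∂jointLaw m, Growth ψ α β c p (Function.update y i x)) →
        Integrable (fun y => ψ (Function.update y i x)) (jointLaw m) ∧
        α + β * ‖x‖ ≤ blockPotential ψ m i x ∧ blockPotential ψ m i x ≤ A * (1 + ‖x‖ ^ p) := by
  set D : ℝ := (d : ℝ) ^ p with hD
  have hD0 : 0 ≤ D := by positivity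
  have hS : Integrable (fun y : Space k => ∑ j, ‖y j‖ ^ p) (jointLaw m) :=
    integrable_finsetSum _ fun j _ => integrable_comp_eval_pi m (hm j)
  set S : ℝ := ∫ y : Space k, ∑ j, ‖y j‖ ^ p ∂jointLaw m with hSdef
  have hS0 : 0 ≤ S := integral_nonneg fun y => Finset.sum_nonneg fun j _ => by positivity
  refine ⟨c * (1 + D + D * S), fun i x hg => ?_⟩
  have hb : ∀ y : Space k, blockNorm (Function.update y i x) ^ p ≤
      D * (‖x‖ ^ p + ∑ j, ‖y j‖ ^ p) := fun y => blockNorm_update_rpow_le hp i x y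
  have hi2 : Integrable (fun y : Space k => ‖x‖ ^ p + ∑ j, ‖y j‖ ^ p) (jointLaw m) :=
    (integrable_const _).add hS
  have hi1 : Integrable (fun y : Space k => 1 + D * (‖x‖ ^ p + ∑ j, ‖y j‖ ^ p)) (jointLaw m) :=
    (integrable_const 1).add (hi2.const_mul D)
  have hi : Integrable (fun y => ψ (Function.update y i x)) (jointLaw m) := by
    refine (hi1.const_mul (|α| + c)).mono'
      (hψ.comp ((Measure.measurable_update_pair i).comp
        measurable_prodMk_left)).aestronglyMeasurable (hg.mono fun y hy => ?_)
    refine (hy.abs_le hβ hc).trans ?_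
    gcongr
    exact hb y
  refine ⟨hi, le_blockPotential hβ hi hg, ?_⟩
  have h1 : blockPotential ψ m i x ≤ ∫ y : Space k, c * (1 + D * (‖x‖ ^ p + ∑ j, ‖y j‖ ^ p))
      ∂jointLaw m := by
    refine integral_mono_ae hi (hi1.const_mul c) (hg.mono fun y hy => hy.2.trans ?_)
    exact mul_le_mul_of_nonneg_left (add_le_add_right (hb y) 1) hc.le
  rw [integral_const_mul, integral_add (integrable_const 1) (hi2.const_mul D), integral_const_mul,
    integral_add (integrable_const _) hS, ← hSdef] at h1
  simp only [integral_const, probReal_univ, smul_eq_mul, one_mul] at h1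
  refine h1.trans ?_
  rw [mul_assoc]
  have hx : 0 ≤ ‖x‖ ^ p := by positivity
  gcongr
  nlinarith [mul_nonneg hD0 hS0, mul_nonneg (mul_nonneg hD0 hS0) hx]

theorem isProbabilityMeasure_tilted_blockPotential {m : Marginals k} {i : Fin d}
    (hψ : Measurable ψ) (hβ : 0 < β)
    (hlow : ∀ᵐ x, α + β * ‖x‖ ≤ blockPotential ψ m i x) :
    IsProbabilityMeasure
      ((volume : Measure (Block k i)).tilted fun x => -blockPotential ψ m i x) :=
  isProbabilityMeasure_tilted
    (integrable_exp_neg_of_le (measurable_blockPotential hψ m i) hβ hlow)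

end BlockUpdate

end CAVI

namespace CAVI

/-! ### The free energy -/

section FreeEnergy

theorem IsGibbs.klDiv_eq {n : ℕ} {p : ℝ} {ν ν' : Measure (EuclideanSpace ℝ (Fin n))}
    [IsProbabilityMeasure ν] [IsProbabilityMeasure ν'] {h h' : EuclideanSpace ℝ (Fin n) → ℝ}
    (hp : 1 ≤ p) (H : IsGibbs p ν h) (H' : IsGibbs p ν' h') :
    klDiv ν ν' = ENNReal.ofReal (∫ x, h' x ∂ν - ∫ x, h x ∂ν) ∧
      0 ≤ ∫ x, h' x ∂ν - ∫ x, h x ∂ν := by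
  have hmom := H.integrable_norm_rpow (q := p) (by linarith)
  have hi := H.integrable_potential H.absolutelyContinuous hmom
  have hi' := H'.integrable_potential H.absolutelyContinuous hmom
  have hmh := H.measurable
  have hmh' := H'.measurable
  rw [← integral_sub hi' hi]
  refine klDiv_withDensity_exp (hmh'.sub hmh) ?_ (hi'.sub hi)
  rw [H.eq, H'.eq, expDensity, expDensity, ← withDensity_mul _ (by fun_prop) (by fun_prop)]
  congr 1
  ext x
  rw [Pi.mul_apply, ← ENNReal.ofReal_mul (Real.exp_pos _).le, ← Real.exp_add]
  congr 2
  ring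

variable {d : ℕ} {k : Fin d → ℕ} {ψ : Space k → ℝ} {α β c p : ℝ}

/-- The product of the measures `e^{-hʲ} dxʲ` has density `e^{ψ - ∑ⱼ hʲ}` with respect to the
target `e^{-ψ} dx`. -/
theorem jointLaw_eq_withDensity (hψ : Measurable ψ) {m : Marginals k}
    {h : (j : Fin d) → Block k j → ℝ} (H : ∀ j, IsGibbs p (m j : Measure (Block k j)) (h j)) :
    jointLaw m = (target ψ).withDensity
      fun x => ENNReal.ofReal (Real.exp (ψ x - ∑ j, h j (x j))) := by
  have hmeas := fun j => (H j).measurable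
  have e : (fun j => (m j : Measure (Block k j))) = fun j =>
      (volume : Measure (Block k j)).withDensity fun x => ENNReal.ofReal (Real.exp (-(h j x))) :=
    funext fun j => (H j).eq
  have hs : ∀ j, SigmaFinite ((volume : Measure (Block k j)).withDensity
      fun x => ENNReal.ofReal (Real.exp (-(h j x)))) := fun j => by
    rw [← congrFun e j]; infer_instance
  have hm : Measurable fun x : Space k => ψ x - ∑ j, h j (x j) :=
    hψ.sub (Finset.measurable_sum _ fun j _ => (hmeas j).comp (measurable_pi_apply j))
  rw [target, ← withDensity_mul _ (by fun_prop) (by fun_prop)]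
  change Measure.pi (fun j => (m j : Measure (Block k j))) = _
  rw [e, Measure.pi_withDensity _ fun j => by have := hmeas j; fun_prop, volume_pi]
  congr 1
  ext x
  rw [Pi.mul_apply, ← ENNReal.ofReal_mul (Real.exp_pos _).le, ← Real.exp_add,
    ← ENNReal.ofReal_prod_of_nonneg fun j _ => (Real.exp_pos _).le, ← Real.exp_sum,
    Finset.sum_neg_distrib]
  congr 2
  ring

theorem ae_growth_of_absolutelyContinuous {m : Marginals k}
    (hac : ∀ j, (m j : Measure (Block k j)) ≪ volume) (hg : ∀ᵐ x : Space k, Growth ψ α β c p x) :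
    ∀ᵐ x ∂jointLaw m, Growth ψ α β c p x :=
  (Measure.pi_absolutelyContinuous hac).ae_le hg

theorem isProbabilityMeasure_target
    (hQ3 : ∫⁻ x : Space k, ENNReal.ofReal (Real.exp (-ψ x)) = 1) :
    IsProbabilityMeasure (target ψ) :=
  ⟨by rw [target, withDensity_apply _ .univ, setLIntegral_univ, hQ3]⟩

theorem integral_sum_comp_eval {m : Marginals k} {h : (j : Fin d) → Block k j → ℝ}
    (hi : ∀ j, Integrable (h j) (m j : Measure (Block k j))) :
    Integrable (fun x : Space k => ∑ j, h j (x j)) (jointLaw m) ∧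
      ∫ x : Space k, ∑ j, h j (x j) ∂jointLaw m = ∑ j, ∫ x, h j x ∂(m j : Measure (Block k j)) := by
  refine ⟨integrable_finsetSum _ fun j _ => integrable_comp_eval_pi m (hi j), ?_⟩
  rw [integral_finsetSum _ fun j _ => integrable_comp_eval_pi m (hi j)]
  exact Finset.sum_congr rfl fun j _ => integral_comp_eval_pi m (hi j)

/-- The entropy of a product of measures `e^{-hʲ} dxʲ` is the free energy
`∫ ψ - ∑ⱼ ∫ hʲ dmʲ`. -/
theorem entropy_eq (hψ : Measurable ψ) (hβ : 0 < β) (hc : 0 < c) (hp : 1 ≤ p)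
    (hg : ∀ᵐ x : Space k, Growth ψ α β c p x)
    (hQ3 : ∫⁻ x : Space k, ENNReal.ofReal (Real.exp (-ψ x)) = 1) {m : Marginals k}
    {h : (j : Fin d) → Block k j → ℝ} (H : ∀ j, IsGibbs p (m j : Measure (Block k j)) (h j)) :
    entropy ψ (ProbabilityMeasure.pi m) = ENNReal.ofReal
      (∫ x, ψ x ∂jointLaw m - ∑ j, ∫ x, h j x ∂(m j : Measure (Block k j))) ∧
    0 ≤ ∫ x, ψ x ∂jointLaw m - ∑ j, ∫ x, h j x ∂(m j : Measure (Block k j)) := by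
  have hmom : HasMoments p m := fun j => (H j).integrable_norm_rpow (by linarith)
  have hac := fun j => (H j).absolutelyContinuous
  have hi := integrable_of_growth hψ hβ hc hp hmom (ae_growth_of_absolutelyContinuous hac hg)
  obtain ⟨hs, hs'⟩ := integral_sum_comp_eval fun j => (H j).integrable_potential (hac j) (hmom j)
  have := isProbabilityMeasure_target hQ3
  have hm : Measurable fun x : Space k => ψ x - ∑ j, h j (x j) :=
    hψ.sub (Finset.measurable_sum _ fun j _ => (H j).measurable.comp (measurable_pi_apply j))
  rw [← hs', ← integral_sub hi hs]
  exact klDiv_withDensity_exp hm (jointLaw_eq_withDensity hψ H) (hi.sub hs)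

/-- If `hⁱ` is the block potential of `m` up to a constant `L`, then integrating out the blocks
other than `i` turns `ψ - ∑ⱼ hʲ` into a constant, so that its integral does not depend on the
`i`-th marginal. -/
theorem integral_sub_sum_eq {m m' : Marginals k} {i : Fin d} {h : (j : Fin d) → Block k j → ℝ}
    {L : ℝ} (hm' : ∀ j, j ≠ i → m' j = m j) (hL : h i = fun x => blockPotential ψ m i x + L)
    (hψi : Integrable ψ (jointLaw m'))
    (hi : ∀ j, j ≠ i → Integrable (h j) (m j : Measure (Block k j))) :
    Integrable (fun x => ψ x - ∑ j, h j (x j)) (jointLaw m') ∧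
      ∫ x, (ψ x - ∑ j, h j (x j)) ∂jointLaw m' =
        -∑ j ∈ Finset.univ.erase i, ∫ x, h j x ∂(m j : Measure (Block k j)) - L := by
  obtain ⟨h1, h2⟩ := integral_jointLaw_eq hm' hψi
  have hi' : ∀ j, Integrable (h j) (m' j : Measure (Block k j)) := fun j => by
    by_cases hj : j = i
    · subst hj; rw [hL]; exact h1.add (integrable_const L)
    · rw [hm' j hj]; exact hi j hj
  obtain ⟨hs, hs'⟩ := integral_sum_comp_eval hi'
  refine ⟨hψi.sub hs, ?_⟩
  rw [integral_sub hψi hs, hs', h2, ← Finset.add_sum_erase _ _ (Finset.mem_univ i), hL,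
    integral_add h1 (integrable_const L)]
  have : ∑ j ∈ Finset.univ.erase i, ∫ x, h j x ∂(m' j : Measure (Block k j)) =
      ∑ j ∈ Finset.univ.erase i, ∫ x, h j x ∂(m j : Measure (Block k j)) :=
    Finset.sum_congr rfl fun j hj => by rw [hm' j (Finset.ne_of_mem_erase hj)]
  rw [this]
  simp only [integral_const, probReal_univ, smul_eq_mul, one_mul]
  ring

/-- The entropy dissipated by updating block `i`: if `m'` arises from `m` by replacing the `i`-th
marginal by the probability density proportional to `e^{-f}`, with `f` the `i`-th block potential
of `m`, then `H(m) = H(mⁱ ‖ m'ⁱ) + H(m')`. -/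
theorem entropy_eq_klDiv_add (hψ : Measurable ψ) (hβ : 0 < β) (hc : 0 < c) (hp : 1 ≤ p)
    (hg : ∀ᵐ x : Space k, Growth ψ α β c p x)
    (hQ3 : ∫⁻ x : Space k, ENNReal.ofReal (Real.exp (-ψ x)) = 1) {m m' : Marginals k} {i : Fin d}
    {h h' : (j : Fin d) → Block k j → ℝ}
    (H : ∀ j, IsGibbs p (m j : Measure (Block k j)) (h j))
    (H' : ∀ j, IsGibbs p (m' j : Measure (Block k j)) (h' j))
    (hm' : ∀ j, j ≠ i → m' j = m j) (hh' : ∀ j, j ≠ i → h' j = h j) {L : ℝ}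
    (hL : h' i = fun x => blockPotential ψ m i x + L) :
    entropy ψ (ProbabilityMeasure.pi m) =
      klDiv (m i : Measure (Block k i)) (m' i) + entropy ψ (ProbabilityMeasure.pi m') := by
  have hmom : HasMoments p m := fun j => (H j).integrable_norm_rpow (by linarith)
  have hmom' : HasMoments p m' := fun j => (H' j).integrable_norm_rpow (by linarith)
  have hac := fun j => (H j).absolutelyContinuous
  have hac' := fun j => (H' j).absolutelyContinuous
  have hi := integrable_of_growth hψ hβ hc hp hmom (ae_growth_of_absolutelyContinuous hac hg)
  have hi' := integrable_of_growth hψ hβ hc hp hmom' (ae_growth_of_absolutelyContinuous hac' hg)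
  have hint : ∀ j, Integrable (h j) (m j : Measure (Block k j)) :=
    fun j => (H j).integrable_potential (hac j) (hmom j)
  have hint' : ∀ j, Integrable (h' j) (m' j : Measure (Block k j)) :=
    fun j => (H' j).integrable_potential (hac' j) (hmom' j)
  have hint'' : ∀ j, j ≠ i → Integrable (h' j) (m j : Measure (Block k j)) :=
    fun j hj => by rw [hh' j hj]; exact hint j
  obtain ⟨e1, -⟩ := entropy_eq hψ hβ hc hp hg hQ3 H
  obtain ⟨e2, p2⟩ := entropy_eq hψ hβ hc hp hg hQ3 H'
  obtain ⟨e3, p3⟩ := (H i).klDiv_eq hp (H' i)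
  rw [e1, e2, e3, ← ENNReal.ofReal_add p3 p2]
  congr 1
  obtain ⟨-, a1⟩ := integral_sub_sum_eq (m := m) (m' := m) (h := h') (fun _ _ => rfl) hL hi hint''
  obtain ⟨-, a2⟩ := integral_sub_sum_eq (m := m) (m' := m') (h := h') hm' hL hi' hint''
  obtain ⟨s2, s2'⟩ := integral_sum_comp_eval hint'
  have hiL : Integrable (h' i) (m i : Measure (Block k i)) :=
    (H' i).integrable_potential (hac i) (hmom i)
  obtain ⟨s1, s1'⟩ := integral_sum_comp_eval (m := m) (h := h') fun j => by
    by_cases hj : j = i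
    · subst hj; exact hiL
    · exact hint'' j hj
  rw [integral_sub hi s1, s1'] at a1
  rw [integral_sub hi' s2, s2'] at a2
  rw [a2, ← a1, ← Finset.add_sum_erase _ _ (Finset.mem_univ i),
    ← Finset.add_sum_erase _ (fun j => ∫ x, h' j x ∂(m j : Measure (Block k j)))
      (Finset.mem_univ i)]
  have : ∑ j ∈ Finset.univ.erase i, ∫ x, h' j x ∂(m j : Measure (Block k j)) =
      ∑ j ∈ Finset.univ.erase i, ∫ x, h j x ∂(m j : Measure (Block k j)) :=
    Finset.sum_congr rfl fun j hj => by rw [hh' j (Finset.ne_of_mem_erase hj)]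
  rw [this]
  ring

/-- A bound on the entropy bounds the normalization constants of the updates from below: bounded
entropy gives a bounded first moment, hence bounded differential entropies of the other blocks. -/
theorem exists_neg_logPartition_le (hψ : Measurable ψ) (hβ : 0 < β) (hc : 0 < c) (hp : 1 ≤ p)
    (hg : ∀ᵐ x : Space k, Growth ψ α β c p x)
    (hQ3 : ∫⁻ x : Space k, ENNReal.ofReal (Real.exp (-ψ x)) = 1) (F : ℝ) (hF : 0 ≤ F) :
    ∃ C : ℝ, ∀ (m m' : Marginals k) (i : Fin d) (h' : (j : Fin d) → Block k j → ℝ) (L : ℝ),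
      (∀ j, IsGibbs p (m' j : Measure (Block k j)) (h' j)) → (∀ j, j ≠ i → m' j = m j) →
      (h' i = fun x => blockPotential ψ m i x + L) →
      entropy ψ (ProbabilityMeasure.pi m') ≤ ENNReal.ofReal F → -L ≤ C := by
  -- With `ε = β / (2d)`, Gibbs' inequality costs at most half of the coercivity `β ∫ |x|` of `∫ ψ`.
  set ε : ℝ := β / (2 * d) with hε
  set K : Fin d → ℝ := fun j => Real.log (∫ x : Block k j, Real.exp (-(ε * ‖x‖))) with hK
  refine ⟨2 * F - α + 2 * ∑ j, |K j|, fun m m' i h' L H' hm' hL hent => ?_⟩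
  have hd : (0 : ℝ) < d := by exact_mod_cast Fin.pos i
  have hε0 : 0 < ε := by positivity
  have hmom' : HasMoments p m' := fun j => (H' j).integrable_norm_rpow (by linarith)
  have hac' := fun j => (H' j).absolutelyContinuous
  have hae := ae_growth_of_absolutelyContinuous hac' hg
  have hi' := integrable_of_growth hψ hβ hc hp hmom' hae
  have hint' : ∀ j, Integrable (h' j) (m' j : Measure (Block k j)) :=
    fun j => (H' j).integrable_potential (hac' j) (hmom' j)
  obtain ⟨e2, p2⟩ := entropy_eq hψ hβ hc hp hg hQ3 H'
  rw [e2, ENNReal.ofReal_le_ofReal_iff hF] at hent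
  obtain ⟨-, a2⟩ := integral_sub_sum_eq (m := m) (m' := m') (h := h') hm' hL hi'
    fun j hj => hm' j hj ▸ hint' j
  obtain ⟨s2, s2'⟩ := integral_sum_comp_eval hint'
  rw [integral_sub hi' s2, s2'] at a2
  have hbn : Integrable (fun x : Space k => blockNorm x) (jointLaw m') := by
    refine ((integrable_const 1).add (hmom'.hasMoment hp)).mono'
      measurable_blockNorm.aestronglyMeasurable (ae_of_all _ fun x => ?_)
    rw [Real.norm_of_nonneg (blockNorm_nonneg x)]
    exact rpow_le_one_add_rpow (blockNorm_nonneg x) hp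
  set M : ℝ := ∫ x, blockNorm x ∂jointLaw m' with hM
  have b1 : α + β * M ≤ ∫ x, ψ x ∂jointLaw m' := by
    have := integral_mono_ae ((integrable_const α).add (hbn.const_mul β)) hi'
      (hae.mono fun x hx => hx.1)
    rw [integral_add' (integrable_const α) (hbn.const_mul β), integral_const_mul] at this
    simp only [integral_const, probReal_univ, smul_eq_mul, one_mul] at this
    exact this
  have b2 : ∀ j, ∫ x, h' j x ∂(m' j : Measure (Block k j)) ≤ ε * M + |K j| := fun j => by
    have hn : Integrable (fun x : Block k j => ‖x‖) (m' j : Measure (Block k j)) := by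
      simpa using (H' j).integrable_norm_rpow (q := 1) zero_le_one
    have c1 := (H' j).integral_potential_le hp hε0
    have c2 : ∫ x : Block k j, ‖x‖ ∂(m' j : Measure (Block k j)) ≤ M := by
      rw [← integral_comp_eval_pi m' hn]
      exact integral_mono (integrable_comp_eval_pi m' hn) hbn fun x => norm_le_blockNorm x j
    have c3 := mul_le_mul_of_nonneg_left c2 hε0.le
    have c4 := le_abs_self (K j)
    simp only [hK] at c4 ⊢
    linarith
  have hM0 : 0 ≤ M := integral_nonneg fun x => blockNorm_nonneg x
  have hdε : (d : ℝ) * ε = β / 2 := by rw [hε]; field_simp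
  have b3 : ∑ j, ∫ x, h' j x ∂(m' j : Measure (Block k j)) ≤ β / 2 * M + ∑ j, |K j| := by
    refine (Finset.sum_le_sum fun j _ => b2 j).trans_eq ?_
    rw [Finset.sum_add_distrib, Finset.sum_const, Finset.card_univ, Fintype.card_fin,
      nsmul_eq_mul, ← mul_assoc, hdε]
  have b4 : ∑ j ∈ Finset.univ.erase i, ∫ x, h' j x ∂(m j : Measure (Block k j)) ≤
      β / 2 * M + ∑ j, |K j| := by
    calc ∑ j ∈ Finset.univ.erase i, ∫ x, h' j x ∂(m j : Measure (Block k j))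
        ≤ ∑ j ∈ Finset.univ.erase i, (ε * M + |K j|) := Finset.sum_le_sum fun j hj => by
          rw [← hm' j (Finset.ne_of_mem_erase hj)]; exact b2 j
      _ ≤ ∑ j, (ε * M + |K j|) :=
          Finset.sum_le_univ_sum_of_nonneg fun j => by positivity
      _ = _ := by
          rw [Finset.sum_add_distrib, Finset.sum_const, Finset.card_univ, Fintype.card_fin,
            nsmul_eq_mul, ← mul_assoc, hdε]
  linarith

/-- A product measure each of whose marginals is proportional to `e^{-fⁱ}`, with `fⁱ` its own
`i`-th block potential, is a stationary point. By the Donsker–Varadhan inequality tested against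
the log-density of `q`, the entropy of any competitor is at least the integral of this log-density,
and this integral is unaffected by the replaced marginal. -/
theorem isStationary_of_isGibbs (hψ : Measurable ψ) (hβ : 0 < β) (hc : 0 < c) (hp : 1 ≤ p)
    (hg : ∀ᵐ x : Space k, Growth ψ α β c p x)
    (hQ3 : ∫⁻ x : Space k, ENNReal.ofReal (Real.exp (-ψ x)) = 1) {q : Marginals k}
    {h : (j : Fin d) → Block k j → ℝ} (H : ∀ j, IsGibbs p (q j : Measure (Block k j)) (h j))
    {L : Fin d → ℝ} (hL : ∀ i, h i = fun x => blockPotential ψ q i x + L i) :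
    IsStationary ψ p (ProbabilityMeasure.pi q) := by
  have hmom : HasMoments p q := fun j => (H j).integrable_norm_rpow (by linarith)
  have hac := fun j => (H j).absolutelyContinuous
  have hψi := integrable_of_growth hψ hβ hc hp hmom (ae_growth_of_absolutelyContinuous hac hg)
  have hint := fun j => (H j).integrable_potential (hac j) (hmom j)
  obtain ⟨e, e0⟩ := entropy_eq hψ hβ hc hp hg hQ3 H
  refine ⟨q, rfl, hmom.hasMoment hp, by rw [e]; exact ENNReal.ofReal_lt_top,
    fun i κ hκ => ?_⟩
  have hri : Function.update q i κ i = κ := Function.update_self ..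
  have hrj : ∀ j, j ≠ i → Function.update q i κ j = q j := fun j hj => Function.update_of_ne hj ..
  generalize Function.update q i κ = r at hri hrj ⊢
  by_cases htop : entropy ψ (ProbabilityMeasure.pi r) = ∞
  · rw [htop]; exact le_top
  have hrmom : HasMoments p r := fun j => by
    by_cases hj : j = i
    · subst hj; rw [hri]; exact hκ
    · rw [hrj j hj]; exact hmom j
  have hrac : jointLaw r ≪ volume :=
    (klDiv_ne_top_iff.1 htop).1.trans (withDensity_absolutelyContinuous _ _)
  have hψr := integrable_of_growth hψ hβ hc hp hrmom (hrac.ae_le hg)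
  have := isProbabilityMeasure_target hQ3
  obtain ⟨x1, x2⟩ := integral_sub_sum_eq (m := q) (m' := r) hrj (hL i) hψr fun j _ => hint j
  obtain ⟨y1, y2⟩ := integral_sub_sum_eq (m := q) (m' := q) (i := i)
    (fun _ _ => rfl) (hL i) hψi fun j _ => hint j
  have hm : Measurable fun x : Space k => ψ x - ∑ j, h j (x j) :=
    hψ.sub (Finset.measurable_sum _ fun j _ => (H j).measurable.comp (measurable_pi_apply j))
  obtain ⟨z1, z2⟩ := integral_exp_eq_one_of_withDensity hm (jointLaw_eq_withDensity hψ H)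
  have dv := integral_le_klDiv_add_log htop x1 z1
  rw [z2, Real.log_one, add_zero, x2, ← y2] at dv
  obtain ⟨s, s'⟩ := integral_sum_comp_eval hint
  rw [integral_sub hψi s, s'] at dv
  rw [e, ← ENNReal.ofReal_toReal htop]
  exact ENNReal.ofReal_le_ofReal dv

end FreeEnergy

end CAVI

namespace CAVI

/-! ### Existence and uniqueness of the iterates -/

section WellPosedness

variable {d : ℕ} {k : Fin d → ℕ} {ψ : Space k → ℝ} {α β c p : ℝ}

/-- Updating block `i` is well-defined, and produces a Gibbs measure, as soon as the growth bounds
hold on almost every section and the current marginals have finite moments. -/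
theorem blockUpdate_of_growth (hψ : Measurable ψ) (hβ : 0 < β) (hc : 0 < c) (hp : 1 ≤ p)
    {m : Marginals k} (hm : HasMoments p m) {i : Fin d}
    (hg : ∀ᵐ x : Block k i, ∀ᵐ y ∂jointLaw m, Growth ψ α β c p (Function.update y i x)) :
    (∀ᵐ x : Block k i, Integrable (fun y => ψ (Function.update y i x)) (jointLaw m)) ∧
    (∀ᵐ x : Block k i, α + β * ‖x‖ ≤ blockPotential ψ m i x) ∧
    IsProbabilityMeasure
      ((volume : Measure (Block k i)).tilted fun x => -blockPotential ψ m i x) ∧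
    IsGibbs p ((volume : Measure (Block k i)).tilted fun x => -blockPotential ψ m i x)
      (fun x => blockPotential ψ m i x + logPartition (blockPotential ψ m i)) := by
  obtain ⟨A, hA⟩ := exists_blockPotential_growth hψ hβ hc hp hm (α := α)
  have hb := hg.mono fun x hx => hA i x hx
  exact ⟨hb.mono fun x hx => hx.1, hb.mono fun x hx => hx.2.1,
    isProbabilityMeasure_tilted_blockPotential hψ hβ (hb.mono fun x hx => hx.2.1),
    isGibbs_tilted (measurable_blockPotential hψ m i) hβ (hb.mono fun x hx => hx.2)⟩

theorem ae_ae_growth_of_absolutelyContinuous {m : Marginals k} {i : Fin d}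
    (hac : ∀ j, j ≠ i → (m j : Measure (Block k j)) ≪ volume)
    (hg : ∀ᵐ x : Space k, Growth ψ α β c p x) :
    ∀ᵐ x : Block k i, ∀ᵐ y ∂jointLaw m, Growth ψ α β c p (Function.update y i x) :=
  ae_ae_update m i (fun _ => volume) hac hg

open Classical in
/-- The updated marginal in block `i`, given the current marginals `m`. Its value is irrelevant if
the update is not defined. -/
noncomputable def blockUpdate (ψ : Space k → ℝ) (m : Marginals k) (i : Fin d) :
    ProbabilityMeasure (Block k i) :=
  if h : IsProbabilityMeasure
      ((volume : Measure (Block k i)).tilted fun x => -blockPotential ψ m i x)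
    then ⟨_, h⟩ else m i

theorem coe_blockUpdate {m : Marginals k} {i : Fin d} (h : IsProbabilityMeasure
    ((volume : Measure (Block k i)).tilted fun x => -blockPotential ψ m i x)) :
    (blockUpdate ψ m i : Measure (Block k i)) =
      (volume : Measure (Block k i)).tilted fun x => -blockPotential ψ m i x := by
  have e : blockUpdate ψ m i = ⟨_, h⟩ := dif_pos h
  rw [e]
  rfl

/-- One full sweep of block updates, by recursion on the block. -/
noncomputable def sweep (ψ : Space k → ℝ) (m : Marginals k) (i : Fin d) :
    ProbabilityMeasure (Block k i) :=
  blockUpdate ψ (fun j => if _h : j < i then sweep ψ m j else m j) i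
termination_by i

/-- The sequence obtained by iterating `sweep`. -/
noncomputable def iterates (ψ : Space k → ℝ) (μ₀ : Marginals k) : ℕ → Marginals k
  | 0 => μ₀
  | n + 1 => sweep ψ (iterates ψ μ₀ n)

theorem iterates_succ (μ₀ : Marginals k) (n : ℕ) (i : Fin d) :
    iterates ψ μ₀ (n + 1) i = blockUpdate ψ (partialIterate (iterates ψ μ₀) n i) i := by
  rw [iterates, sweep]
  rfl

/-- If every update in the first sweep respects the growth bounds, then all iterates are
well-defined. From the second sweep on only null sets of Lebesgue measure matter. -/
theorem isCAVI_iterates (hψ : Measurable ψ) (hβ : 0 < β) (hc : 0 < c) (hp : 1 ≤ p)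
    (hg : ∀ᵐ x : Space k, Growth ψ α β c p x) {μ₀ : Marginals k} (hμ₀ : HasMoments p μ₀)
    (hfirst : ∀ i, ∀ᵐ x ∂firstSweepMeasure μ₀ i, Growth ψ α β c p x) :
    IsCAVI ψ (iterates ψ μ₀) := by
  set μ := iterates ψ μ₀ with hμ
  have hstep : ∀ n i, μ (n + 1) i = blockUpdate ψ (partialIterate μ n i) i :=
    iterates_succ μ₀
  -- The block update in sweep `n` is well-defined if the earlier updates of that sweep were.
  have main : ∀ n, HasMoments p (μ n) → (n = 0 ∨ ∀ j, (μ n j : Measure (Block k j)) ≪ volume) →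
      ∀ i : Fin d, ((∀ᵐ x : Block k i, Integrable (fun y => ψ (Function.update y i x))
          (jointLaw (partialIterate μ n i))) ∧
        (μ (n + 1) i : Measure (Block k i)) = (volume : Measure (Block k i)).tilted
          fun x => -blockPotential ψ (partialIterate μ n i) i x) ∧
        Integrable (fun x => ‖x‖ ^ p) (μ (n + 1) i : Measure (Block k i)) := by
    intro n hmom hn i
    induction i using WellFoundedLT.induction with
    | ind i ih =>
      have hm : HasMoments p (partialIterate μ n i) := fun j => by
        unfold partialIterate
        split_ifs with hj
        · exact (ih j hj).2
        · exact hmom j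
      have hac : ∀ j, j < i → (μ (n + 1) j : Measure (Block k j)) ≪ volume := fun j hj =>
        (ih j hj).1.2 ▸ tilted_absolutelyContinuous _ _
      have hsec : ∀ᵐ x : Block k i, ∀ᵐ y ∂jointLaw (partialIterate μ n i),
          Growth ψ α β c p (Function.update y i x) := by
        rcases hn with rfl | hn
        · have hs : ∀ j, SigmaFinite (if j ≤ i then (volume : Measure (Block k j))
              else (μ₀ j : Measure (Block k j))) := fun j => by
            split_ifs <;> infer_instance
          have := ae_ae_update (partialIterate μ 0 i) i (fun j => if j ≤ i then
            (volume : Measure (Block k j)) else (μ₀ j : Measure (Block k j))) (fun j hj => by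
              unfold partialIterate
              by_cases h1 : j < i
              · simpa only [h1, h1.le, if_true] using hac j h1
              · have h2 : ¬ j ≤ i := fun h => h1 (lt_of_le_of_ne h hj)
                simp only [h1, h2, if_false]
                exact Measure.AbsolutelyContinuous.rfl) (hfirst i)
          simpa only [le_refl, if_true] using this
        · refine ae_ae_growth_of_absolutelyContinuous (fun j _ => ?_) hg
          unfold partialIterate
          split_ifs with hj
          · exact hac j hj
          · exact hn j
      obtain ⟨h1, -, h3, h4⟩ := blockUpdate_of_growth hψ hβ hc hp hm hsec
      have e : (μ (n + 1) i : Measure (Block k i)) = (volume : Measure (Block k i)).tilted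
          fun x => -blockPotential ψ (partialIterate μ n i) i x := by
        rw [hstep, coe_blockUpdate h3]
      exact ⟨⟨h1, e⟩, by rw [e]; exact h4.integrable_norm_rpow (by linarith)⟩
  have hinv : ∀ n, HasMoments p (μ n) ∧ (n = 0 ∨ ∀ j, (μ n j : Measure (Block k j)) ≪ volume) := by
    intro n
    induction n with
    | zero => exact ⟨hμ₀, Or.inl rfl⟩
    | succ n ih =>
      exact ⟨fun i => (main n ih.1 ih.2 i).2, Or.inr fun i =>
        (main n ih.1 ih.2 i).1.2 ▸ tilted_absolutelyContinuous _ _⟩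
  exact fun n i => (main n (hinv n).1 (hinv n).2 i).1

theorem IsCAVI.unique {μ μ' : ℕ → Marginals k} (h : IsCAVI ψ μ) (h' : IsCAVI ψ μ')
    (h0 : μ 0 = μ' 0) : μ = μ' := by
  funext n
  induction n with
  | zero => exact h0
  | succ n ih =>
    funext i
    induction i using WellFoundedLT.induction with
    | ind i ihi =>
      have e : partialIterate μ n i = partialIterate μ' n i := by
        funext j
        unfold partialIterate
        split_ifs with hj
        · exact ihi j hj
        · rw [ih]
      refine Subtype.ext ?_
      have h1 := (h n i).2
      rw [e, ← (h' n i).2] at h1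
      exact h1

end WellPosedness

end CAVI

/-! ### Domination of products and tightness -/

namespace MeasureTheory

theorem Measure.pi_le_smul {n : ℕ} {E : Fin n → Type*} [∀ i, MeasurableSpace (E i)]
    {μ ν : (i : Fin n) → Measure (E i)} [∀ i, IsFiniteMeasure (μ i)] [∀ i, IsFiniteMeasure (ν i)]
    {B : NNReal} (h : ∀ i, μ i ≤ B • ν i) : Measure.pi μ ≤ (B ^ n) • Measure.pi ν := by
  refine (Measure.pi_mono h).trans_eq (Measure.pi_eq fun s _ => ?_)
  simp only [Measure.smul_apply, Measure.pi_pi, ENNReal.smul_def, smul_eq_mul]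
  rw [Finset.prod_mul_distrib]
  simp

/-- A sequence of finite measures that is eventually dominated by a finite measure is tight. -/
theorem isTightMeasureSet_range_of_le {Ω : Type*} [MeasurableSpace Ω] [TopologicalSpace Ω]
    [TopologicalSpace.IsCompletelyPseudoMetrizableSpace Ω] [SecondCountableTopology Ω]
    [BorelSpace Ω] {P : ℕ → Measure Ω} [∀ n, IsFiniteMeasure (P n)] {Λ : Measure Ω}
    [IsFiniteMeasure Λ] {N : ℕ} (h : ∀ n, P (n + N) ≤ Λ) :
    IsTightMeasureSet (Set.range P) := by
  have hfin : IsFiniteMeasure (Λ + ∑ n ∈ Finset.range N, P n) := inferInstance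
  have ht : IsTightMeasureSet {Λ + ∑ n ∈ Finset.range N, P n} := isTightMeasureSet_singleton
  rw [isTightMeasureSet_iff_exists_isCompact_measure_compl_le] at ht ⊢
  intro ε hε
  obtain ⟨K, hK, hle⟩ := ht ε hε
  refine ⟨K, hK, ?_⟩
  rintro _ ⟨n, rfl⟩
  refine le_trans (?_ : P n ≤ Λ + ∑ n ∈ Finset.range N, P n) le_rfl Kᶜ |>.trans (hle _ rfl)
  rcases lt_or_ge n N with hn | hn
  · refine Measure.le_add_left (Measure.le_iff.2 fun s _ => ?_)
    rw [Measure.finsetSum_apply]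
    exact Finset.single_le_sum (f := fun n => P n s) (fun _ _ => zero_le) (Finset.mem_range.2 hn)
  · obtain ⟨l, rfl⟩ := Nat.exists_eq_add_of_le' hn
    exact (h l).trans (Measure.le_add_right le_rfl)

end MeasureTheory

namespace CAVI

/-! ### Dissipation of entropy along the iterates -/

section Convergence

variable {d : ℕ} {k : Fin d → ℕ} {ψ : Space k → ℝ} {α β c p : ℝ}

theorem IsCAVI.absolutelyContinuous {μ : ℕ → Marginals k} (h : IsCAVI ψ μ) (n : ℕ) (i : Fin d) :
    (μ (n + 1) i : Measure (Block k i)) ≪ volume :=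
  (h n i).2 ▸ tilted_absolutelyContinuous _ _

theorem IsCAVI.shift {μ : ℕ → Marginals k} (h : IsCAVI ψ μ) (N : ℕ) :
    IsCAVI ψ fun n => μ (n + N) := fun n i => by
  have e : partialIterate (fun n => μ (n + N)) n i = partialIterate μ (n + N) i := by
    funext j
    simp only [partialIterate, Nat.add_right_comm n 1 N]
  have := h (n + N) i
  rw [← e, ← Nat.add_right_comm n 1 N] at this
  exact this

/-- The marginals of the partial iterates inherit every property of the iterates. -/
theorem partialIterate_induction {μ : ℕ → Marginals k} {n : ℕ}
    {P : (j : Fin d) → Measure (Block k j) → Prop}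
    (h : ∀ j, P j (μ n j)) (h' : ∀ j, P j (μ (n + 1) j)) (i j : Fin d) :
    P j (partialIterate μ n i j) := by
  unfold partialIterate
  split_ifs
  exacts [h' j, h j]

/-- After the first sweep, the block potentials grow at least linearly, whether or not the iterates
have finite moments. -/
theorem IsCAVI.le_blockPotential (hβ : 0 < β) (hg : ∀ᵐ x : Space k, Growth ψ α β c p x)
    {μ : ℕ → Marginals k} (h : IsCAVI ψ μ) (n : ℕ) (i : Fin d) :
    ∀ᵐ x : Block k i, α + β * ‖x‖ ≤ blockPotential ψ (partialIterate μ (n + 1) i) i x := by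
  filter_upwards [(h (n + 1) i).1, ae_ae_growth_of_absolutelyContinuous (i := i)
    (fun j _ => partialIterate_induction (k := k) (μ := μ) (n := n + 1)
      (P := fun _ ν => ν ≪ volume)
      (h.absolutelyContinuous n) (h.absolutelyContinuous (n + 1)) i j) hg] with x h1 h2
  exact CAVI.le_blockPotential hβ h1 h2

theorem IsCAVI.hasMoments (hψ : Measurable ψ) (hβ : 0 < β) (hp : 1 ≤ p)
    (hg : ∀ᵐ x : Space k, Growth ψ α β c p x) {μ : ℕ → Marginals k} (h : IsCAVI ψ μ) (n : ℕ) :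
    HasMoments p (μ (n + 2)) := fun i => by
  have hm := measurable_blockPotential hψ (partialIterate μ (n + 1) i) i
  have hlow := h.le_blockPotential hβ hg n i
  rw [(h (n + 1) i).2, tilted_neg_eq_expDensity (integrable_exp_neg_of_le hm hβ hlow)]
  exact integrable_norm_rpow_expDensity (hm.add_const _) (by linarith) hβ
    (a := α + logPartition (blockPotential ψ (partialIterate μ (n + 1) i) i))
    (hlow.mono fun x hx => by linarith)

/-- From the third sweep on, all iterates are Gibbs measures. -/
theorem IsCAVI.isGibbs (hψ : Measurable ψ) (hβ : 0 < β) (hc : 0 < c) (hp : 1 ≤ p)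
    (hg : ∀ᵐ x : Space k, Growth ψ α β c p x) {μ : ℕ → Marginals k} (h : IsCAVI ψ μ) (n : ℕ)
    (i : Fin d) : IsGibbs p (μ (n + 3) i : Measure (Block k i)) fun x =>
      blockPotential ψ (partialIterate μ (n + 2) i) i x +
        logPartition (blockPotential ψ (partialIterate μ (n + 2) i) i) := by
  rw [(h (n + 2) i).2]
  refine (blockUpdate_of_growth hψ hβ hc hp (fun j => ?_) (α := α)
    (ae_ae_growth_of_absolutelyContinuous (fun j _ => ?_) hg)).2.2.2
  · exact partialIterate_induction (k := k) (μ := μ) (n := n + 2)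
      (P := fun _ ν => Integrable (fun x => ‖x‖ ^ p) ν) (h.hasMoments hψ hβ hp hg n)
      (h.hasMoments hψ hβ hp hg (n + 1)) i j
  · exact partialIterate_induction (k := k) (μ := μ) (n := n + 2) (P := fun _ ν => ν ≪ volume)
      (h.absolutelyContinuous (n + 1)) (h.absolutelyContinuous (n + 2)) i j

/-- The family interpolating between `u` (for `l = 0`) and `v` (for `l = d`) that agrees with `v` on
the first `l` blocks. -/
def interpolate {T : Fin d → Type*} (u v : (j : Fin d) → T j) (l : ℕ) : (j : Fin d) → T j :=
  fun j => if j.val < l then v j else u j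

/-- Along a sequence of Gibbs iterates the entropy stays bounded, and the relative entropies
`H(μₙⁱ ‖ μₙ₊₁ⁱ)` of successive iterates are dissipated: they are bounded by the decrement of the
entropy in one sweep. -/
theorem entropy_sweep (hψ : Measurable ψ) (hβ : 0 < β) (hc : 0 < c) (hp : 1 ≤ p)
    (hg : ∀ᵐ x : Space k, Growth ψ α β c p x)
    (hQ3 : ∫⁻ x : Space k, ENNReal.ofReal (Real.exp (-ψ x)) = 1) {ν : ℕ → Marginals k}
    {h : ℕ → (j : Fin d) → Block k j → ℝ} {L : ℕ → Fin d → ℝ}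
    (H : ∀ n j, IsGibbs p (ν n j : Measure (Block k j)) (h n j))
    (hL : ∀ n i, h (n + 1) i = fun x => blockPotential ψ (partialIterate ν n i) i x + L n i)
    (n : ℕ) (i : Fin d) :
    klDiv (ν n i : Measure (Block k i)) (ν (n + 1) i) +
        entropy ψ (ProbabilityMeasure.pi (ν (n + 1))) ≤ entropy ψ (ProbabilityMeasure.pi (ν n)) ∧
      entropy ψ (ProbabilityMeasure.pi (interpolate (ν n) (ν (n + 1)) (i + 1))) ≤
        entropy ψ (ProbabilityMeasure.pi (ν n)) := by
  set M : ℕ → Marginals k := fun l => interpolate (ν n) (ν (n + 1)) l with hM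
  have HM : ∀ l j, IsGibbs p (M l j : Measure (Block k j))
      (interpolate (h n) (h (n + 1)) l j) := fun l j => by
    simp only [hM, interpolate]
    split_ifs
    exacts [H (n + 1) j, H n j]
  have hlt : ∀ {l : ℕ} {j : Fin d}, j.val ≠ l → (j.val < l + 1 ↔ j.val < l) := fun hj => by omega
  have step : ∀ j : Fin d, entropy ψ (ProbabilityMeasure.pi (M j)) =
      klDiv (ν n j : Measure (Block k j)) (ν (n + 1) j) +
        entropy ψ (ProbabilityMeasure.pi (M (j + 1))) := fun j => by
    have e := entropy_eq_klDiv_add hψ hβ hc hp hg hQ3 (m := M j) (m' := M (j + 1)) (i := j)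
      (HM j) (HM (j + 1)) (L := L n j)
      (fun l hl => by simp only [hM, interpolate, hlt (fun h => hl (Fin.ext h))])
      (fun l hl => by simp only [interpolate, hlt (fun h => hl (Fin.ext h))])
      (by
        have : M j = partialIterate ν n j := rfl
        rw [this, ← hL n j]
        simp [interpolate])
    have e1 : M j j = ν n j := by simp [hM, interpolate]
    have e2 : M (j + 1) j = ν (n + 1) j := by simp [hM, interpolate]
    rwa [e1, e2] at e
  have hanti : Antitone fun l => entropy ψ (ProbabilityMeasure.pi (M l)) := by
    refine antitone_nat_of_succ_le fun l => ?_
    rcases lt_or_ge l d with hl | hl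
    · rw [step ⟨l, hl⟩]
      exact le_add_self
    · refine le_of_eq (congrArg _ (congrArg _ (funext fun j => ?_)))
      have h1 : j.val < l := j.2.trans_le hl
      simp [hM, interpolate, h1, h1.trans (Nat.lt_succ_self l)]
  have e0 : M 0 = ν n := funext fun j => by simp [hM, interpolate]
  have ed : M d = ν (n + 1) := funext fun j => by simp [hM, interpolate]
  refine ⟨?_, e0 ▸ hanti (Nat.zero_le _)⟩
  calc klDiv (ν n i : Measure (Block k i)) (ν (n + 1) i) +
        entropy ψ (ProbabilityMeasure.pi (ν (n + 1)))
      ≤ klDiv (ν n i : Measure (Block k i)) (ν (n + 1) i) +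
        entropy ψ (ProbabilityMeasure.pi (M (i + 1))) := by
        gcongr
        rw [← ed]
        exact hanti i.2
    _ = entropy ψ (ProbabilityMeasure.pi (M i)) := (step i).symm
    _ ≤ entropy ψ (ProbabilityMeasure.pi (ν n)) := e0 ▸ hanti (Nat.zero_le _)

/-- A sequence bounded by the decrements of a finite antitone one tends to zero. -/
theorem tendsto_zero_of_add_le {a e : ℕ → ℝ≥0∞} (h : ∀ n, a n + e (n + 1) ≤ e n) (h0 : e 0 ≠ ∞) :
    (∀ n, e n ≤ e 0) ∧ (∀ n, a n ≠ ∞) ∧ Tendsto (fun n => (a n).toReal) atTop (𝓝 0) := by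
  have hanti : Antitone e := antitone_nat_of_succ_le fun n => le_add_self.trans (h n)
  have he : ∀ n, e n ≤ e 0 := fun n => hanti (Nat.zero_le n)
  have hfin : ∀ n, e n ≠ ∞ := fun n => ne_top_of_le_ne_top h0 (he n)
  have ha : ∀ n, a n ≠ ∞ := fun n =>
    ne_top_of_le_ne_top (hfin n) (le_self_add.trans (h n))
  refine ⟨he, ha, ?_⟩
  have hlim := (ENNReal.tendsto_toReal (ne_top_of_le_ne_top h0 (iInf_le e 0))).comp
    (tendsto_atTop_iInf hanti)
  have hdiff := hlim.sub (hlim.comp (tendsto_add_atTop_nat 1))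
  rw [sub_self] at hdiff
  refine squeeze_zero (fun n => ENNReal.toReal_nonneg) (fun n => ?_) hdiff
  have := ENNReal.toReal_mono (hfin n) (h n)
  rw [ENNReal.toReal_add (ha n) (hfin _)] at this
  simp only [Function.comp_apply]
  linarith

end Convergence

end CAVI

namespace CAVI

/-! ### Limit points -/

section LimitPoints

variable {d : ℕ} {k : Fin d → ℕ} {ψ : Space k → ℝ} {α β c p : ℝ}

/-- Along Gibbs iterates, consecutive iterates become close in relative entropy, and all iterates
are dominated by a multiple of one fixed product measure with finite moments. -/
theorem IsCAVI.exists_domination (hψ : Measurable ψ) (hβ : 0 < β) (hc : 0 < c) (hp : 1 ≤ p)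
    (hg : ∀ᵐ x : Space k, Growth ψ α β c p x)
    (hQ3 : ∫⁻ x : Space k, ENNReal.ofReal (Real.exp (-ψ x)) = 1) {μ : ℕ → Marginals k}
    (hμ : IsCAVI ψ μ) :
    (∀ i, (∀ n, klDiv (μ (n + 3) i : Measure (Block k i)) (μ (n + 4) i) ≠ ∞) ∧
      Tendsto (fun n => (klDiv (μ (n + 3) i : Measure (Block k i)) (μ (n + 4) i)).toReal) atTop
        (𝓝 0)) ∧
    ∃ (g : Marginals k) (B : NNReal), HasMoments p g ∧
      (∀ j, (g j : Measure (Block k j)) ≪ volume) ∧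
      ∀ n j, (μ (n + 4) j : Measure (Block k j)) ≤ B • (g j : Measure (Block k j)) := by
  set ν : ℕ → Marginals k := fun n => μ (n + 3) with hνdef
  have hν : IsCAVI ψ ν := hμ.shift 3
  set L : ℕ → Fin d → ℝ := fun n i => logPartition (blockPotential ψ (partialIterate ν n i) i)
    with hLdef
  set h : ℕ → (j : Fin d) → Block k j → ℝ := fun n i x =>
    blockPotential ψ (partialIterate μ (n + 2) i) i x +
      logPartition (blockPotential ψ (partialIterate μ (n + 2) i) i) with hh
  have H : ∀ n j, IsGibbs p (ν n j : Measure (Block k j)) (h n j) :=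
    hμ.isGibbs hψ hβ hc hp hg
  have hL : ∀ n i, h (n + 1) i =
      fun x => blockPotential ψ (partialIterate ν n i) i x + L n i := fun n i => by
    have e : partialIterate ν n i = partialIterate μ (n + 1 + 2) i := by
      funext j
      simp only [partialIterate, hνdef]
    simp only [hh, hLdef, e]
  have hsw := entropy_sweep hψ hβ hc hp hg hQ3 H hL
  have h0 : entropy ψ (ProbabilityMeasure.pi (ν 0)) ≠ ∞ := by
    rw [(entropy_eq hψ hβ hc hp hg hQ3 (H 0)).1]
    exact ENNReal.ofReal_ne_top
  refine ⟨fun i => (tendsto_zero_of_add_le (fun n => (hsw n i).1) h0).2, ?_⟩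
  obtain ⟨C, hC⟩ := exists_neg_logPartition_le hψ hβ hc hp hg hQ3
    (entropy ψ (ProbabilityMeasure.pi (ν 0))).toReal ENNReal.toReal_nonneg
  have hLC : ∀ n i, -L n i ≤ C := fun n i => by
    refine hC (partialIterate ν n i) (interpolate (ν n) (ν (n + 1)) (i + 1)) i
      (interpolate (h n) (h (n + 1)) (i + 1)) (L n i) (fun j => ?_) (fun j hj => ?_) ?_ ?_
    · simp only [interpolate]
      split_ifs
      exacts [H (n + 1) j, H n j]
    · have : j.val ≠ i.val := fun h => hj (Fin.ext h)
      have h1 : (j.val < i.val + 1) ↔ j < i := by rw [Fin.lt_def]; omega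
      simp only [interpolate, partialIterate, h1]
    · rw [← hL n i]
      simp [interpolate]
    · rw [ENNReal.ofReal_toReal h0]
      exact (hsw n i).2.trans ((tendsto_zero_of_add_le (fun n => (hsw n i).1) h0).1 n)
  -- The reference measure in block `j` is the normalization of `e^{-β|x|} dx`.
  have hG : ∀ j, IsGibbs p ((volume : Measure (Block k j)).tilted fun x => -(β * ‖x‖))
      fun x => β * ‖x‖ + logPartition fun x : Block k j => β * ‖x‖ := fun j =>
    isGibbs_tilted (by fun_prop) hβ (a := 0) (A := β) (ae_of_all _ fun x =>
      ⟨by linarith, mul_le_mul_of_nonneg_left (rpow_le_one_add_rpow (norm_nonneg x) hp) hβ.le⟩)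
  have hGp : ∀ j, IsProbabilityMeasure
      ((volume : Measure (Block k j)).tilted fun x => -(β * ‖x‖)) := fun j =>
    isProbabilityMeasure_tilted (integrable_exp_neg_mul_norm hβ)
  set l : Fin d → ℝ := fun j => logPartition fun x : Block k j => β * ‖x‖ with hl
  refine ⟨fun j => ⟨_, hGp j⟩, Real.toNNReal (Real.exp (C - α + ∑ j, |l j|)),
    fun j => (hG j).integrable_norm_rpow (by linarith), fun j => (hG j).absolutelyContinuous,
    fun n j => ?_⟩
  have hm : Measurable (h (n + 1) j) := (H (n + 1) j).measurable
  change (ν (n + 1) j : Measure (Block k j)) ≤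
    ENNReal.ofReal (Real.exp (C - α + ∑ j, |l j|)) •
      (volume : Measure (Block k j)).tilted fun x => -(β * ‖x‖)
  rw [(H (n + 1) j).eq, (hG j).eq, expDensity, expDensity, ← withDensity_smul _ (by fun_prop)]
  refine withDensity_mono ?_
  filter_upwards [hμ.le_blockPotential hβ hg (n + 2) j] with x hx
  rw [Pi.smul_apply, smul_eq_mul, ← ENNReal.ofReal_mul (Real.exp_pos _).le, ← Real.exp_add]
  refine ENNReal.ofReal_le_ofReal (Real.exp_le_exp.2 ?_)
  have h1 : l j ≤ ∑ j, |l j| := (le_abs_self _).trans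
    (Finset.single_le_sum (f := fun j => |l j|) (fun _ _ => abs_nonneg _) (Finset.mem_univ j))
  have h2 := hLC n j
  have h3 : h (n + 1) j x = blockPotential ψ (partialIterate μ (n + 2 + 1) j) j x + L n j := by
    rw [hL]
    rfl
  change -(h (n + 1) j x) ≤ C - α + ∑ j, |l j| + -(β * ‖x‖ + l j)
  linarith

/-- The image of a product measure under a coordinate projection. -/
theorem map_eval_pi (m : Marginals k) (j : Fin d) :
    (ProbabilityMeasure.pi m).map (continuous_apply j).measurable.aemeasurable = m j :=
  Subtype.ext (measurePreserving_eval_pi m j).map_eq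

/-- Weak limits of products of probability measures are products, of the limits of the factors. -/
theorem exists_eq_pi_of_tendsto {u : ℕ → Marginals k} {m : ProbabilityMeasure (Space k)}
    (h : Tendsto (fun t => ProbabilityMeasure.pi (u t)) atTop (𝓝 m)) :
    ∃ q : Marginals k, m = ProbabilityMeasure.pi q ∧
      ∀ j, Tendsto (fun t => u t j) atTop (𝓝 (q j)) := by
  have hj : ∀ j, Tendsto (fun t => u t j) atTop
      (𝓝 (m.map (continuous_apply j).measurable.aemeasurable)) := fun j => by
    have := ProbabilityMeasure.tendsto_map_of_tendsto_of_continuous _ _ h (continuous_apply j)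
    simpa only [map_eval_pi] using this
  refine ⟨fun j => m.map (continuous_apply j).measurable.aemeasurable, ?_, hj⟩
  exact tendsto_nhds_unique h
    ((ProbabilityMeasure.continuous_pi.tendsto _).comp (tendsto_pi_nhds.2 hj))

/-- Convergence of the block potentials implies convergence of the integrals of bounded functions
against `e^{-f}`, by dominated convergence. -/
theorem tendsto_integral_exp_neg {n : ℕ} {f : ℕ → EuclideanSpace ℝ (Fin n) → ℝ}
    {f' : EuclideanSpace ℝ (Fin n) → ℝ} (hf : ∀ t, Measurable (f t)) {a b : ℝ} (hb : 0 < b)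
    (hlow : ∀ t, ∀ᵐ x, a + b * ‖x‖ ≤ f t x)
    (hlim : ∀ᵐ x, Tendsto (fun t => f t x) atTop (𝓝 (f' x)))
    {g : EuclideanSpace ℝ (Fin n) → ℝ} (hg : Measurable g) {B : ℝ} (hB : ∀ x, |g x| ≤ B) :
    Tendsto (fun t => ∫ x, Real.exp (-f t x) * g x) atTop (𝓝 (∫ x, Real.exp (-f' x) * g x)) := by
  refine tendsto_integral_of_dominated_convergence
    (fun x => Real.exp (-a) * Real.exp (-(b * ‖x‖)) * B) (fun t => ?_)
    (((integrable_exp_neg_mul_norm hb).const_mul _).mul_const _) (fun t => ?_) ?_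
  · have := hf t
    exact Measurable.aestronglyMeasurable (by fun_prop)
  · filter_upwards [hlow t] with x hx
    rw [norm_mul, Real.norm_eq_abs, Real.abs_exp, ← Real.exp_add]
    exact mul_le_mul (Real.exp_le_exp.2 (by linarith)) (hB x) (norm_nonneg _) (Real.exp_pos _).le
  · filter_upwards [hlim] with x hx
    exact ((Real.continuous_exp.tendsto _).comp hx.neg).mul_const _

/-- Limit points of the iterates are stationary. -/
theorem IsCAVI.isStationary_of_tendsto (hψ : Measurable ψ) (hβ : 0 < β) (hc : 0 < c) (hp : 1 ≤ p)
    (hg : ∀ᵐ x : Space k, Growth ψ α β c p x)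
    (hQ3 : ∫⁻ x : Space k, ENNReal.ofReal (Real.exp (-ψ x)) = 1) {μ : ℕ → Marginals k}
    (hμ : IsCAVI ψ μ) {s : ℕ → ℕ} (hs : Tendsto s atTop atTop)
    {m : ProbabilityMeasure (Space k)}
    (hm : Tendsto (fun t => ProbabilityMeasure.pi (μ (s t + 4))) atTop (𝓝 m)) :
    IsStationary ψ p m := by
  obtain ⟨hkl, g, B, hgm, hgac, hdom⟩ := hμ.exists_domination hψ hβ hc hp hg hQ3
  obtain ⟨q, rfl, hq⟩ := exists_eq_pi_of_tendsto hm
  -- The next iterates have the same limits, since the relative entropies tend to zero.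
  have hq' : ∀ j, Tendsto (fun t => μ (s t + 5) j) atTop (𝓝 (q j)) := fun j => by
    rw [ProbabilityMeasure.tendsto_iff_forall_integral_tendsto]
    intro f
    have h1 := (ProbabilityMeasure.tendsto_iff_forall_integral_tendsto.1 (hq j)) f
    have h2 := tendsto_integral_sub_of_klDiv_tendsto_zero
      (P := fun n => (μ (n + 3) j : Measure (Block k j)))
      (R := fun n => (μ (n + 4) j : Measure (Block k j))) (hkl j).1 (hkl j).2
      f.continuous.measurable (B := ‖f‖) f.norm_coe_le_norm
    have h3 := h1.sub (h2.comp ((tendsto_add_atTop_nat 1).comp hs))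
    rw [sub_zero] at h3
    refine h3.congr fun t => ?_
    simp only [Function.comp_apply]
    rw [show s t + 1 + 3 = s t + 4 by ring, show s t + 1 + 4 = s t + 5 by ring]
    ring
  have hqle : ∀ j, (q j : Measure (Block k j)) ≤ B • (g j : Measure (Block k j)) := fun j =>
    ProbabilityMeasure.le_of_tendsto_of_le (hq j) fun t => hdom (s t) j
  have hqac : ∀ j, (q j : Measure (Block k j)) ≪ volume := fun j =>
    (Measure.absolutelyContinuous_of_le (hqle j)).trans
      ((Measure.smul_absolutelyContinuous (c := B)).trans (hgac j))
  have hqm : HasMoments p q := fun j => ((hgm j).smul_measure_nnreal).mono_measure (hqle j)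
  have hup := fun i : Fin d => blockUpdate_of_growth hψ hβ hc hp hqm (i := i)
    (ae_ae_growth_of_absolutelyContinuous (fun j _ => hqac j) hg)
  suffices hfix : ∀ i, (q i : Measure (Block k i)) =
      (volume : Measure (Block k i)).tilted fun x => -blockPotential ψ q i x from
    isStationary_of_isGibbs hψ hβ hc hp hg hQ3 (fun i => (hfix i) ▸ (hup i).2.2.2) fun i => rfl
  intro i
  set u : ℕ → Marginals k := fun t => partialIterate μ (s t + 4) i with hu
  have hulim : Tendsto (fun t => ProbabilityMeasure.pi (u t)) atTop
      (𝓝 (ProbabilityMeasure.pi q)) := by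
    refine (ProbabilityMeasure.continuous_pi.tendsto q).comp (tendsto_pi_nhds.2 fun j => ?_)
    simp only [hu, partialIterate]
    split_ifs
    exacts [hq' j, hq j]
  have hule : ∀ t, jointLaw (u t) ≤ (B ^ d) • jointLaw g := fun t =>
    Measure.pi_le_smul (partialIterate_induction (k := k) (μ := μ) (n := s t + 4)
      (P := fun j ν => ν ≤ B • (g j : Measure (Block k j))) (hdom (s t))
      (fun j => by
        rw [show s t + 4 + 1 = s t + 1 + 4 by ring]
        exact hdom (s t + 1) j) i)
  have hlim : ∀ᵐ x : Block k i, Tendsto (fun t => blockPotential ψ (u t) i x) atTop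
      (𝓝 (blockPotential ψ q i x)) := by
    filter_upwards [(blockUpdate_of_growth hψ hβ hc hp hgm (i := i)
      (ae_ae_growth_of_absolutelyContinuous (fun j _ => hgac j) hg)).1] with x hx
    exact ProbabilityMeasure.tendsto_integral_of_le hulim hule hx.smul_measure_nnreal
  have hconv : ∀ {f : Block k i → ℝ}, Measurable f → ∀ {b : ℝ}, (∀ x, |f x| ≤ b) →
      Tendsto (fun t => ∫ x, Real.exp (-blockPotential ψ (u t) i x) * f x) atTop
        (𝓝 (∫ x, Real.exp (-blockPotential ψ q i x) * f x)) := fun hf _ hb =>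
    tendsto_integral_exp_neg (fun t => measurable_blockPotential hψ (u t) i) hβ
      (fun t => hμ.le_blockPotential hβ hg (s t + 3) i) hlim hf hb
  have htilt : ∀ (r : Marginals k) (f : Block k i → ℝ),
      ∫ x, f x ∂((volume : Measure (Block k i)).tilted fun x => -blockPotential ψ r i x) =
        (∫ x, Real.exp (-blockPotential ψ r i x) * f x) /
          ∫ x, Real.exp (-blockPotential ψ r i x) * 1 := fun r f => by
    rw [integral_tilted, ← integral_div]
    simp only [smul_eq_mul, mul_one, div_mul_eq_mul_div]
  have hZ : ∫ x, Real.exp (-blockPotential ψ q i x) * 1 ≠ 0 := by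
    simp only [mul_one]
    exact (integral_exp_pos (integrable_exp_neg_of_le (measurable_blockPotential hψ q i) hβ
      (hup i).2.1)).ne'
  have hprob := (hup i).2.2.1
  refine ext_of_forall_integral_eq_of_IsFiniteMeasure fun f => ?_
  refine tendsto_nhds_unique
    ((ProbabilityMeasure.tendsto_iff_forall_integral_tendsto.1 (hq' i)) f) ?_
  rw [htilt]
  refine ((hconv f.continuous.measurable f.norm_coe_le_norm).div
    (hconv measurable_const (b := 1) fun x => by simp) hZ).congr fun t => ?_
  rw [(hμ (s t + 4) i).2, htilt]
  rfl

end LimitPoints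

end CAVI

theorem mainTheorem3 {d : ℕ} (k : Fin d → ℕ) (ψ : CAVI.Space k → ℝ) (hψ : Measurable ψ)
    (α β c p : ℝ) (hβ : 0 < β) (hc : 0 < c) (hp : 1 ≤ p)
    (hQ1 : ∀ᵐ x : CAVI.Space k, α + β * CAVI.blockNorm x ≤ ψ x)
    (hQ2 : ∀ᵐ x : CAVI.Space k, ψ x ≤ c * (1 + CAVI.blockNorm x ^ p))
    (hQ3 : ∫⁻ x : CAVI.Space k, ENNReal.ofReal (Real.exp (-ψ x)) = 1)
    (μ₀ : CAVI.Marginals k) (hμ₀ : CAVI.HasMoment p (ProbabilityMeasure.pi μ₀)) :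
    ((∀ i : Fin d, ∀ᵐ x ∂(CAVI.firstSweepMeasure μ₀ i),
        α + β * CAVI.blockNorm x ≤ ψ x ∧ ψ x ≤ c * (1 + CAVI.blockNorm x ^ p)) →
      ∃! μ : ℕ → CAVI.Marginals k, μ 0 = μ₀ ∧ CAVI.IsCAVI ψ μ) ∧
    (∀ μ : ℕ → CAVI.Marginals k, μ 0 = μ₀ → CAVI.IsCAVI ψ μ →
      IsTightMeasureSet
        (Set.range (fun n => (ProbabilityMeasure.pi (μ n) : Measure (CAVI.Space k)))) ∧
      ∀ (m : ProbabilityMeasure (CAVI.Space k)) (φ : ℕ → ℕ), StrictMono φ →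
        Tendsto (fun t => ProbabilityMeasure.pi (μ (φ t))) atTop (𝓝 m) →
          CAVI.IsStationary ψ p m) := by
  have hg : ∀ᵐ x : CAVI.Space k, CAVI.Growth ψ α β c p x := hQ1.and hQ2
  refine ⟨fun hfirst => ?_, fun μ _ hμ => ⟨?_, fun m φ hφ hm => ?_⟩⟩
  · have hC := CAVI.isCAVI_iterates hψ hβ hc hp hg (hμ₀.hasMoments hp) hfirst
    exact ⟨_, ⟨rfl, hC⟩, fun μ' h' => h'.2.unique hC h'.1⟩
  · obtain ⟨-, g, B, -, -, hdom⟩ := hμ.exists_domination hψ hβ hc hp hg hQ3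
    exact isTightMeasureSet_range_of_le (Λ := (B ^ d) • CAVI.jointLaw g) (N := 4)
      fun n => Measure.pi_le_smul (hdom n)
  · -- The first four iterates are dropped: `φ (t + 4) ≥ 4`.
    have hφ4 : ∀ t, φ (t + 4) - 4 + 4 = φ (t + 4) := fun t =>
      Nat.sub_add_cancel (le_trans (Nat.le_add_left 4 t) (hφ.id_le (t + 4)))
    refine hμ.isStationary_of_tendsto hψ hβ hc hp hg hQ3 (s := fun t => φ (t + 4) - 4)
      ((tendsto_sub_atTop_nat 4).comp (hφ.tendsto_atTop.comp (tendsto_add_atTop_nat 4))) ?_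
    simp only [hφ4]
    exact hm.comp (tendsto_add_atTop_nat 4)
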